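/- For partitions $\alpha,\beta$ of $d\ge 1$ and integers $g\ge 0$, $r\ge 1$ such that $rs=2g-2+l(\alpha)+l(\beta)$ for some integer $s\ge 0$ (where $l$ is the number of parts), the double Hurwitz number with completed $(r+1)$-cycles is $$H^{g,(r)}_{\alpha,\beta}=\frac{1}{\prod_i\alpha_i\prod_j\beta_j}\sum_{\lambda\vdash d}\chi^\lambda_\alpha\left(\frac{p_{r+1}(\lambda)}{(r+1)!}\right)^{s}\chi^\lambda_\beta ,\qquad p_k(\lambda)=\sum_{i\ge1}\left(\left(\lambda_i-i+\tfrac12\right)^k-\left(-i+\tfrac12\right)^k\right),$$ where $\chi^\lambda_\mu$ is the irreducible character of the symmetric group $S_d$ associated with $\lambda$ evaluated at permutations of cycle structure $\mu$. Let $g\ge 0$, let $n\ge 1$ be odd, and put $s=g+\frac{n-1}{2}$. Then there is a unique polynomial $P_{g,n}\in\mathbb{Q}[\beta_1,\dots,\beta_n]$ such that $$P_{g,n}(\beta_1,\dots,\beta_n)=\frac{d\,H^{g,(2)}_{(d),\beta}}{s!},\qquad d=\beta_1+\dots+\beta_n,$$ for all positive integers $\beta_1,\dots,\beta_n$, where $\beta$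 on the right is the partition of $d$ with parts $\beta_1,\dots,\beta_n$. For integers $b_1,\dots,b_n\ge 0$ with $b_1+\dots+b_n=g+\frac{n-1}{2}$, define the lowest-degree combinatorial Hodge integral by $$\langle\langle\tau_{b_1}\cdots\tau_{b_n}\Lambda_{2g}\rangle\rangle_g=(-1)^g\left[\beta_1^{b_1}\cdots\beta_n^{b_n}\right]P_{g,n}.$$ Then $$\langle\langle\tau_{b_1}\cdots\tau_{b_n}\Lambda_{2g}\rangle\rangle_g=\binom{g+\frac{n-1}{2}}{b_1,\dots,b_n}\,\mathbf{C}_{g,n},\qquad \mathbf{C}_{g,n}=\frac{(2g+n-1)!\,\left|2^{2g-1}-1\right|}{(2g)!\,\left(g+\frac{n-1}{2}\right)!\,2^{3g+\frac{n-3}{2}}}\,|B_{2g}|,$$ where $B_{2g}$ is the Bernoulli number ($B_0=1$, $B_2=\frac16$, $B_4=-\frac1{30},\dots$). -/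

import Mathlib

namespace CompletedCycles

open Finset

noncomputable section

/-! ### Partitions and Young diagrams -/

/-- The Young diagram of a partition `lam`, whose rows are the parts in weakly decreasing order. -/
def diagram {d : ℕ} (lam : d.Partition) : YoungDiagram :=
  YoungDiagram.ofRowLens (lam.parts.sort (· ≥ ·)) (lam.parts.pairwise_sort (· ≥ ·)).sortedGE

theorem card_cellsOfRowLens (w : List ℕ) : #(YoungDiagram.cellsOfRowLens w) = w.sum := by
  induction w with
  | nil => rfl
  | cons a w ih =>
    rw [YoungDiagram.cellsOfRowLens, card_union_of_disjoint, card_product, card_map, ih]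
    · simp
    · simp [disjoint_left]

theorem card_diagram {d : ℕ} (lam : d.Partition) : #(diagram lam).cells = d := by
  have h := card_cellsOfRowLens (lam.parts.sort (· ≥ ·))
  rw [← Multiset.sum_coe, Multiset.sort_eq, lam.parts_sum] at h
  exact h

/-- A Young tableau of shape `lam`: a numbering of the cells by `Fin d`. -/
abbrev Tableau {d : ℕ} (lam : d.Partition) : Type := (diagram lam).cells ≃ Fin d

/-- A fixed tableau of shape `lam`. -/
def tableau {d : ℕ} (lam : d.Partition) : Tableau lam :=
  equivFinOfCardEq (card_diagram lam)

/-! ### The irreducible representations and characters of the symmetric group -/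

/-- The permutations which map every row of the tableau to itself. -/
def rowStabilizer {d : ℕ} {lam : d.Partition} (T : Tableau lam) : Finset (Equiv.Perm (Fin d)) :=
  {σ | ∀ i, (T.symm (σ i)).1.1 = (T.symm i).1.1}

/-- The permutations which map every column of the tableau to itself. -/
def colStabilizer {d : ℕ} {lam : d.Partition} (T : Tableau lam) : Finset (Equiv.Perm (Fin d)) :=
  {σ | ∀ i, (T.symm (σ i)).1.2 = (T.symm i).1.2}

/-- The Young symmetrizer of a tableau in the group algebra `ℚ S_d`: the sum over the row
stabilizer times the signed sum over the column stabilizer. -/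
def youngSymmetrizer {d : ℕ} {lam : d.Partition} (T : Tableau lam) :
    MonoidAlgebra ℚ (Equiv.Perm (Fin d)) :=
  (∑ p ∈ rowStabilizer T, MonoidAlgebra.of ℚ _ p) *
    ∑ q ∈ colStabilizer T, ((Equiv.Perm.sign q : ℤ) : ℚ) • MonoidAlgebra.of ℚ _ q

/-- The Specht module: the left ideal of `ℚ S_d` generated by the Young symmetrizer. -/
abbrev spechtModule {d : ℕ} (lam : d.Partition) :
    Submodule (MonoidAlgebra ℚ (Equiv.Perm (Fin d))) (MonoidAlgebra ℚ (Equiv.Perm (Fin d))) :=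
  Submodule.span _ {youngSymmetrizer (tableau lam)}

/-- The irreducible representation of `S_d` associated with `lam`: the action of `S_d` by left
multiplication on the Specht module. -/
def spechtRep {d : ℕ} (lam : d.Partition) :
    Representation ℚ (Equiv.Perm (Fin d)) (spechtModule lam) :=
  ((Algebra.lsmul ℚ ℚ (spechtModule lam) :
    MonoidAlgebra ℚ (Equiv.Perm (Fin d)) →ₐ[ℚ] Module.End ℚ (spechtModule lam)) :
      MonoidAlgebra ℚ (Equiv.Perm (Fin d)) →* Module.End ℚ (spechtModule lam)).comp
    (MonoidAlgebra.of ℚ (Equiv.Perm (Fin d)))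

theorem exists_perm_of_partition {d : ℕ} (mu : d.Partition) :
    ∃ σ : Equiv.Perm (Fin d), σ.partition.parts = mu.parts := by
  have hsplit := Multiset.filter_add_not (fun k => 2 ≤ k) mu.parts
  have hone : mu.parts.filter (fun k => ¬ 2 ≤ k) =
      Multiset.replicate (Multiset.card (mu.parts.filter (fun k => ¬ 2 ≤ k))) 1 := by
    refine Multiset.eq_replicate_card.2 fun b hb => ?_
    have h1 := mu.parts_pos (Multiset.mem_of_mem_filter hb)
    have h2 := (Multiset.mem_filter.1 hb).2
    omega
  have hsum := congrArg Multiset.sum hsplit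
  rw [Multiset.sum_add, mu.parts_sum, hone, Multiset.sum_replicate, smul_eq_mul, mul_one] at hsum
  obtain ⟨σ, hσ⟩ := (Equiv.Perm.exists_with_cycleType_iff (Fin d)
    (m := mu.parts.filter (fun k => 2 ≤ k))).2
      ⟨by rw [Fintype.card_fin]; omega, fun a ha => (Multiset.mem_filter.1 ha).2⟩
  refine ⟨σ, ?_⟩
  rw [Equiv.Perm.parts_partition, ← Equiv.Perm.sum_cycleType, hσ, Fintype.card_fin]
  conv_rhs => rw [← hsplit, hone]
  congr 2
  omega

/-- The value `χ^lam_mu` of the irreducible character associated with `lam` at the permutations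
of cycle structure `mu`. -/
def chi {d : ℕ} (lam mu : d.Partition) : ℚ :=
  (spechtRep lam).character (exists_perm_of_partition mu).choose

/-! ### Double Hurwitz numbers with completed cycles -/

/-- The shifted symmetric power sum `p_k` at a partition. Row `i` of the diagram (counted from `0`)
has length `λ_{i+1}`; the terms beyond the last row vanish. -/
def shiftedPowerSum (k : ℕ) {d : ℕ} (lam : d.Partition) : ℚ :=
  ∑ i ∈ range (Multiset.card lam.parts),
    ((((diagram lam).rowLen i : ℚ) - (i + 1) + 1 / 2) ^ k - (-((i : ℚ) + 1) + 1 / 2) ^ k)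

/-- The disconnected double Hurwitz number `H^{g,(r)}_{α,β}` with completed `(r+1)`-cycles. It is
meant for `α`, `β` such that `r` divides `2g - 2 + l(α) + l(β)`; the quotient is `s`. -/
def hurwitz (g r : ℕ) {d : ℕ} (α β : d.Partition) : ℚ :=
  1 / ((α.parts.prod : ℚ) * (β.parts.prod : ℚ)) *
    ∑ lam : d.Partition,
      chi lam α *
        (shiftedPowerSum (r + 1) lam / ((r + 1).factorial : ℚ)) ^
          ((2 * g + Multiset.card α.parts + Multiset.card β.parts - 2) / r) *
        chi lam β

/-- The partition of `β_1 + … + β_n` with parts `β_1, …, β_n` (for positive `β_i`). -/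
def partitionOf {n : ℕ} (β : Fin n → ℕ) : (∑ i, β i).Partition :=
  Nat.Partition.ofSums _ (univ.val.map β) rfl

/-- The one-part double Hurwitz number `H^{g,(2)}_{(d),β}` with completed 3-cycles,
`d = β_1 + … + β_n`. -/
def onePartHurwitz (g : ℕ) {n : ℕ} (β : Fin n → ℕ) : ℚ :=
  hurwitz g 2 (Nat.Partition.indiscrete (∑ i, β i)) (partitionOf β)

/-! ### Combinatorial Hodge integrals -/

/-- `P` is a polynomial in `β_1, …, β_n` that agrees with `d H^{g,(2)}_{(d),β} / s!`,
`s = g + (n-1)/2`, at all positive integers `β_1, …, β_n`. -/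
def IsHurwitzPolynomial (g n : ℕ) (P : MvPolynomial (Fin n) ℚ) : Prop :=
  ∀ β : Fin n → ℕ, (∀ i, 0 < β i) →
    MvPolynomial.eval (fun i => (β i : ℚ)) P =
      ((∑ i, β i : ℕ) : ℚ) * onePartHurwitz g β / ((g + (n - 1) / 2).factorial : ℚ)

open Classical in
/-- The combinatorial Hodge integral `⟨⟨τ_{b_1} … τ_{b_n} Λ_{2k}⟩⟩_g`: `(-1)^k` times the
coefficient of `β_1^{b_1} … β_n^{b_n}` in the polynomial `d H^{g,(2)}_{(d),β} / s!`. It is meant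
for odd `n`, `k ≤ g` and `b_1 + … + b_n + 2k = 3g + (n-1)/2`. -/
def hodgeIntegral (g k : ℕ) {n : ℕ} (b : Fin n → ℕ) : ℚ :=
  if h : ∃ P : MvPolynomial (Fin n) ℚ, IsHurwitzPolynomial g n P then
    (-1) ^ k * MvPolynomial.coeff (Finsupp.equivFunOnFinite.symm b) h.choose
  else 0

/-- The constant `C_{g,n}`, for odd `n`. -/
def hodgeConstant (g n : ℕ) : ℚ :=
  ((2 * g + n - 1).factorial : ℚ) * |(2 : ℚ) ^ (2 * (g : ℤ) - 1) - 1| /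
      (((2 * g).factorial : ℚ) * ((g + (n - 1) / 2).factorial : ℚ) *
        (2 : ℚ) ^ (3 * (g : ℤ) + ((n : ℤ) - 3) / 2)) *
    |bernoulli (2 * g)|

end

end CompletedCycles

/-!
The class sum of the `d`-cycles is a product of the star sums `(i 1) + … + (i i-1)`. Being central,
it commutes with the row factor of the Young symmetrizer. For a non-hook, the symmetrizer of a
`2 × 2` square splits off between the row and the column factor, and a star sum kills it. So the
characters of non-hooks vanish at `d`-cycles.

For a hook with leg `k`, the character at `g` is the normalised trace of `y ↦ g y c`, where `c` is
the Young symmetrizer. For the products of a row symmetrizer of `Bᶜ` and a column antisymmetrizer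
of `B`, these traces are, up to normalisation, the coefficients of
`det (1 - x g) = ∏ (1 - x ^ β_i)`; adjoining a point to `Bᶜ` or `B` gives a recursion, whence
`χ(g) = (-1) ^ k [x ^ k] ∏ (1 - x ^ β_i) / (1 - x)`.

As `p_3 / 3! = d³ / 24 + d / 2 * ((d - 1) / 2 - k) ^ 2` for hooks, `d H / s!` is a combination of
moments with exponential generating function `∏ 2 sinh (β_i z / 2) / (2 sinh (z / 2))`, and hence
polynomial in `β`. To its part of lowest degree the factors `sinh (β_i z / 2) / (β_i z / 2)`
contribute only their constant term, and `z / (2 sinh (z / 2))` provides the Bernoulli number.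
-/

namespace CompletedCycles

open Finset Equiv Equiv.Perm
open MonoidAlgebra (of)

section TwistedSum

variable {G : Type*} [Group G]

/-- The element `∑ ε(σ) σ` of the rational group algebra, with `σ` running over `s`. -/
noncomputable def twistedSum (ε : G →* ℤˣ) (s : Finset G) : MonoidAlgebra ℚ G :=
  ∑ σ ∈ s, ε σ • of ℚ G σ

theorem of_mul_twistedSum (ε : G →* ℤˣ) {s : Finset G} {σ : G} (h : ∀ τ, σ * τ ∈ s ↔ τ ∈ s) :
    of ℚ G σ * twistedSum ε s = ε σ • twistedSum ε s := by
  rw [twistedSum, mul_sum, smul_sum]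
  refine sum_equiv (Equiv.mulLeft σ) (by simp [h]) fun τ _ => ?_
  rw [mul_smul_comm, ← map_mul, smul_smul, Equiv.coe_mulLeft, map_mul ε, ← mul_assoc,
    Int.units_mul_self, one_mul]

theorem twistedSum_mul_of (ε : G →* ℤˣ) {s : Finset G} {σ : G} (h : ∀ τ, τ * σ ∈ s ↔ τ ∈ s) :
    twistedSum ε s * of ℚ G σ = ε σ • twistedSum ε s := by
  rw [twistedSum, sum_mul, smul_sum]
  refine sum_equiv (Equiv.mulRight σ) (by simp [h]) fun τ _ => ?_
  rw [smul_mul_assoc, ← map_mul, smul_smul, Equiv.coe_mulRight, map_mul ε, mul_left_comm,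
    Int.units_mul_self, mul_one]

theorem twistedSum_mul_twistedSum_eq_left (ε : G →* ℤˣ) {s t : Finset G}
    (h : ∀ σ ∈ t, ∀ τ, τ * σ ∈ s ↔ τ ∈ s) :
    twistedSum ε s * twistedSum ε t = #t • twistedSum ε s := by
  rw [twistedSum.eq_1 ε t, mul_sum, ← sum_const]
  refine sum_congr rfl fun σ hσ => ?_
  rw [mul_smul_comm, twistedSum_mul_of ε (h σ hσ), smul_smul, Int.units_mul_self, one_smul]

theorem twistedSum_mul_twistedSum_eq_right (ε : G →* ℤˣ) {s t : Finset G}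
    (h : ∀ σ ∈ t, ∀ τ, σ * τ ∈ s ↔ τ ∈ s) :
    twistedSum ε t * twistedSum ε s = #t • twistedSum ε s := by
  rw [twistedSum.eq_1 ε t, sum_mul, ← sum_const]
  refine sum_congr rfl fun σ hσ => ?_
  rw [smul_mul_assoc, of_mul_twistedSum ε (h σ hσ), smul_smul, Int.units_mul_self, one_smul]

theorem semiconjBy_twistedSum (ε : G →* ℤˣ) {s t : Finset G} {σ : G}
    (h : ∀ τ, σ * τ * σ⁻¹ ∈ t ↔ τ ∈ s) :
    SemiconjBy (of ℚ G σ) (twistedSum ε s) (twistedSum ε t) := by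
  rw [SemiconjBy, twistedSum, twistedSum, sum_mul, mul_sum]
  refine sum_equiv (MulAut.conj σ).toEquiv (by simp [h]) fun τ _ => ?_
  have hε : ε (σ * τ * σ⁻¹) = ε τ := by rw [map_mul, map_mul, map_inv, mul_inv_cancel_comm]
  simp [hε, mul_smul_comm]

theorem commute_twistedSum_left {ε : G →* ℤˣ} {s : Finset G} {x : MonoidAlgebra ℚ G}
    (h : ∀ σ ∈ s, Commute (of ℚ G σ) x) : Commute (twistedSum ε s) x :=
  Commute.sum_left _ _ _ fun σ hσ => (h σ hσ).smul_left _

end TwistedSum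

section Symmetrizer

variable {α : Type*} [DecidableEq α]

theorem mem_permsOfFinset {X : Finset α} {σ : Perm α} :
    σ ∈ permsOfFinset X ↔ ∀ i ∉ X, σ i = i := by
  rw [mem_perms_of_finset_iff]
  exact ⟨fun h i hi => not_not.1 (mt h hi), fun h i hne => not_not.1 (mt (h i) hne)⟩

theorem mem_permsOfFinset_iff_mem_fixingSubgroup {X : Finset α} {σ : Perm α} :
    σ ∈ permsOfFinset X ↔ σ ∈ fixingSubgroup (Perm α) (X : Set α)ᶜ := by
  simp [mem_permsOfFinset, mem_fixingSubgroup_iff]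

theorem mul_mem_permsOfFinset_iff_right {X : Finset α} {σ : Perm α} (hσ : σ ∈ permsOfFinset X)
    (τ : Perm α) : σ * τ ∈ permsOfFinset X ↔ τ ∈ permsOfFinset X := by
  simp only [mem_permsOfFinset_iff_mem_fixingSubgroup] at hσ ⊢
  exact Subgroup.mul_mem_cancel_left _ hσ

theorem mul_mem_permsOfFinset_iff_left {X : Finset α} {σ : Perm α} (hσ : σ ∈ permsOfFinset X)
    (τ : Perm α) : τ * σ ∈ permsOfFinset X ↔ τ ∈ permsOfFinset X := by
  simp only [mem_permsOfFinset_iff_mem_fixingSubgroup] at hσ ⊢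
  exact Subgroup.mul_mem_cancel_right _ hσ

theorem inv_mem_permsOfFinset {X : Finset α} {σ : Perm α} (hσ : σ ∈ permsOfFinset X) :
    σ⁻¹ ∈ permsOfFinset X := by
  simp only [mem_permsOfFinset_iff_mem_fixingSubgroup] at hσ ⊢
  exact inv_mem hσ

theorem swap_mem_permsOfFinset {X : Finset α} {i j : α} (hi : i ∈ X) (hj : j ∈ X) :
    swap i j ∈ permsOfFinset X :=
  mem_permsOfFinset.2 fun _ hl =>
    swap_apply_of_ne_of_ne (ne_of_mem_of_not_mem hi hl).symm (ne_of_mem_of_not_mem hj hl).symm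

theorem permsOfFinset_mono {X Y : Finset α} (h : X ⊆ Y) : permsOfFinset X ⊆ permsOfFinset Y :=
  fun _ hσ => mem_permsOfFinset.2 fun i hi => mem_permsOfFinset.1 hσ i (notMem_mono h hi)

theorem apply_mem_iff_of_mem_permsOfFinset {X : Finset α} {σ : Perm α} (hσ : σ ∈ permsOfFinset X)
    {i : α} : σ i ∈ X ↔ i ∈ X := by
  constructor <;> intro h <;> by_contra hi
  · exact hi (mem_permsOfFinset.1 hσ i hi ▸ h)
  · exact hi (by rwa [σ.injective (mem_permsOfFinset.1 hσ _ hi)])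

theorem mem_permsOfFinset_insert {o : α} {X : Finset α} {σ : Perm α} :
    σ ∈ permsOfFinset (insert o X) ↔
      σ o ∈ insert o X ∧ swap o (σ o) * σ ∈ permsOfFinset X := by
  constructor
  · intro hσ
    have hσo := (apply_mem_iff_of_mem_permsOfFinset hσ).2 (mem_insert_self o X)
    refine ⟨hσo, mem_permsOfFinset.2 fun i hi => ?_⟩
    by_cases hio : i = o
    · simp [hio]
    · exact mem_permsOfFinset.1 ((mul_mem_permsOfFinset_iff_right
        (swap_mem_permsOfFinset (mem_insert_self o X) hσo) σ).2 hσ) i (by simp [hi, hio])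
  · rintro ⟨hσo, hσ⟩
    exact (mul_mem_permsOfFinset_iff_right
      (swap_mem_permsOfFinset (mem_insert_self o X) hσo) σ).1
        (permsOfFinset_mono (subset_insert o X) hσ)

theorem commute_of_mem_permsOfFinset {X Y : Finset α} (h : _root_.Disjoint X Y) {σ τ : Perm α}
    (hσ : σ ∈ permsOfFinset X) (hτ : τ ∈ permsOfFinset Y) : Commute σ τ := by
  refine Equiv.Perm.Disjoint.commute fun i => ?_
  by_cases hi : i ∈ X
  · exact Or.inr (mem_permsOfFinset.1 hτ i (disjoint_left.1 h hi))
  · exact Or.inl (mem_permsOfFinset.1 hσ i hi)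

/-- The sum of the permutations of `X`, twisted by `ε`: for `ε = 1` the row symmetrizer and for
`ε = sign` the column antisymmetrizer of `X`. -/
noncomputable def symmetrizer (ε : Perm α →* ℤˣ) (X : Finset α) : MonoidAlgebra ℚ (Perm α) :=
  twistedSum ε (permsOfFinset X)

/-- The twisted sum of the transpositions `(o i)`, `i ∈ X`, as in a Jucys–Murphy element; a term
with `i = o` is the identity. -/
noncomputable def starSum (ε : Perm α →* ℤˣ) (o : α) (X : Finset α) : MonoidAlgebra ℚ (Perm α) :=
  ∑ i ∈ X, ε (swap o i) • of ℚ _ (swap o i)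

theorem of_mul_symmetrizer (ε : Perm α →* ℤˣ) {X : Finset α} {σ : Perm α}
    (hσ : σ ∈ permsOfFinset X) : of ℚ _ σ * symmetrizer ε X = ε σ • symmetrizer ε X :=
  of_mul_twistedSum ε (mul_mem_permsOfFinset_iff_right hσ)

theorem symmetrizer_mul_of (ε : Perm α →* ℤˣ) {X : Finset α} {σ : Perm α}
    (hσ : σ ∈ permsOfFinset X) : symmetrizer ε X * of ℚ _ σ = ε σ • symmetrizer ε X :=
  twistedSum_mul_of ε (mul_mem_permsOfFinset_iff_left hσ)

theorem symmetrizer_mul_symmetrizer (ε : Perm α →* ℤˣ) {X Y : Finset α} (h : Y ⊆ X) :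
    symmetrizer ε X * symmetrizer ε Y = (#Y).factorial • symmetrizer ε X := by
  rw [← card_perms_of_finset]
  exact twistedSum_mul_twistedSum_eq_left ε fun σ hσ =>
    mul_mem_permsOfFinset_iff_left (permsOfFinset_mono h hσ)

theorem commute_of_symmetrizer (ε : Perm α →* ℤˣ) {X Y : Finset α} (h : _root_.Disjoint X Y)
    {σ : Perm α} (hσ : σ ∈ permsOfFinset X) : Commute (of ℚ _ σ) (symmetrizer ε Y) :=
  Commute.sum_right _ _ _ fun _ hτ =>
    ((commute_of_mem_permsOfFinset h hσ hτ).map (of ℚ (Perm α))).smul_right _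

theorem commute_symmetrizer (ε ε' : Perm α →* ℤˣ) {X Y : Finset α} (h : _root_.Disjoint X Y) :
    Commute (symmetrizer ε X) (symmetrizer ε' Y) :=
  commute_twistedSum_left fun _ hσ => commute_of_symmetrizer ε' h hσ

theorem twistedSum_eq_starSum_mul (ε : Perm α →* ℤˣ) {o : α} {Y : Finset α}
    {s t : Finset (Perm α)} (ht : ∀ τ ∈ t, τ o = o)
    (hs : ∀ σ, σ ∈ s ↔ σ o ∈ Y ∧ swap o (σ o) * σ ∈ t) :
    twistedSum ε s = starSum ε o Y * twistedSum ε t := by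
  rw [twistedSum, twistedSum, starSum, sum_mul_sum, ← sum_product']
  refine sum_bij' (fun σ _ => (σ o, swap o (σ o) * σ)) (fun p _ => swap o p.1 * p.2)
    (fun σ hσ => mem_product.2 ((hs σ).1 hσ)) ?_ (by simp [← mul_assoc]) ?_ ?_
  · rintro ⟨i, τ⟩ hp
    obtain ⟨hi, hτ⟩ := mem_product.1 hp
    exact (hs _).2 (by simpa [ht τ hτ, ← mul_assoc] using And.intro hi hτ)
  · rintro ⟨i, τ⟩ hp
    simp [ht τ (mem_product.1 hp).2, ← mul_assoc]
  · intro σ _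
    rw [smul_mul_smul_comm, ← map_mul, ← map_mul, swap_mul_self_mul]

theorem symmetrizer_insert_left (ε : Perm α →* ℤˣ) {o : α} {X : Finset α} (ho : o ∉ X) :
    symmetrizer ε (insert o X) = starSum ε o (insert o X) * symmetrizer ε X :=
  twistedSum_eq_starSum_mul ε (fun _ hτ => mem_permsOfFinset.1 hτ o ho) fun _ =>
    mem_permsOfFinset_insert

theorem starSum_insert_self (ε : Perm α →* ℤˣ) {o : α} {X : Finset α} (ho : o ∉ X) :
    starSum ε o (insert o X) = 1 + starSum ε o X := by
  rw [starSum, sum_insert ho, starSum, swap_self, ← Equiv.Perm.one_def, map_one, map_one, one_smul]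

theorem commute_of_starSum (ε : Perm α →* ℤˣ) {o : α} {X : Finset α} (ho : o ∉ X) {σ : Perm α}
    (hσ : σ ∈ permsOfFinset X) : Commute (of ℚ _ σ) (starSum ε o X) := by
  rw [commute_iff_eq, starSum, mul_sum, sum_mul]
  refine sum_equiv σ (fun i => (apply_mem_iff_of_mem_permsOfFinset hσ).symm) fun i _ => ?_
  have hconj : swap o (σ i) * σ = σ * swap o i := by
    rw [mul_swap_eq_swap_mul, mem_permsOfFinset.1 hσ o ho]
  have hε : ε (swap o (σ i)) = ε (swap o i) := by
    rw [← mul_left_inj (ε σ), ← map_mul, hconj, map_mul, mul_comm]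
  rw [mul_smul_comm, smul_mul_assoc, ← map_mul, ← map_mul, hconj, hε]

variable [Fintype α]

theorem symmetrizer_mul_of_mul_symmetrizer_eq_zero {A B : Finset α} {σ : Perm α} {x y : α}
    (hxy : x ≠ y) (hx : x ∈ B) (hy : y ∈ B) (hσx : σ x ∈ A) (hσy : σ y ∈ A) :
    symmetrizer 1 A * of ℚ _ σ * symmetrizer sign B = 0 := by
  have hA := symmetrizer_mul_of 1 (swap_mem_permsOfFinset hσx hσy)
  have hB := of_mul_symmetrizer sign (swap_mem_permsOfFinset hx hy)
  rw [MonoidHom.one_apply, one_smul] at hA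
  rw [sign_swap hxy, Units.neg_smul, one_smul] at hB
  have : IsAddTorsionFree (MonoidAlgebra ℚ (Perm α)) := .of_module_rat _
  rw [← self_eq_neg]
  nth_rw 1 [← hA]
  rw [mul_assoc (symmetrizer 1 A), ← map_mul, ← mul_swap_eq_swap_mul, map_mul, ← mul_assoc,
    mul_assoc _ (of ℚ _ (swap x y)), hB, mul_neg]

/-- The product of the row symmetrizer of `A` and the column antisymmetrizer of `B`. If `A` and `B`
share one point, this is the Young symmetrizer of the hook with arm `A` and leg `B`. -/
noncomputable def rowCol (A B : Finset α) : MonoidAlgebra ℚ (Perm α) :=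
  symmetrizer 1 A * symmetrizer sign B

theorem symmetrizer_mul_of_mul_swap_mul_symmetrizer {A B C : Finset α} {o i : α} (hoA : o ∈ A)
    (hoB : o ∉ B) (hiA : i ∈ A) (hiB : i ∉ B) (hBC : B ⊆ C) {τ : Perm α}
    (hτ : τ ∈ permsOfFinset B) :
    symmetrizer 1 A * of ℚ _ (τ * swap o i) * symmetrizer sign C = sign τ • rowCol A C := by
  have hcomm : Commute τ (swap o i) := commute_of_mem_permsOfFinset (Y := {o, i})
    (by simp [hoB, hiB]) hτ (swap_mem_permsOfFinset (by simp) (by simp))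
  rw [hcomm.eq, map_mul, ← mul_assoc, symmetrizer_mul_of 1 (swap_mem_permsOfFinset hoA hiA),
    MonoidHom.one_apply, one_smul, mul_assoc, of_mul_symmetrizer sign (permsOfFinset_mono hBC hτ),
    mul_smul_comm, rowCol]

theorem symmetrizer_mul_of_mul_swap_mul_symmetrizer_eq_zero {A B : Finset α} {o i : α}
    (hoA : o ∈ A) (hiA : i ∈ A) (hiB : i ∉ insert o B) {τ : Perm α}
    (hτ : τ ∈ permsOfFinset (insert o B)) (hτB : τ ∉ permsOfFinset B) :
    symmetrizer 1 A * of ℚ _ (τ * swap o i) * symmetrizer sign (insert o B) = 0 := by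
  have hτi : τ i = i := mem_permsOfFinset.1 hτ i hiB
  have hτo : τ⁻¹ o ≠ o := fun h => hτB <| mem_permsOfFinset.2 fun j hj => by
    by_cases hjo : j = o
    · rw [hjo, eq_comm, ← Perm.inv_eq_iff_eq, h]
    · exact mem_permsOfFinset.1 hτ j (by simp [hjo, hj])
  have hmem : τ⁻¹ o ∈ insert o B :=
    (apply_mem_iff_of_mem_permsOfFinset (inv_mem_permsOfFinset hτ)).2 (mem_insert_self o B)
  refine symmetrizer_mul_of_mul_symmetrizer_eq_zero hτo.symm (mem_insert_self o B) hmem ?_ ?_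
  · rwa [Perm.mul_apply, swap_apply_left, hτi]
  · rwa [Perm.mul_apply, swap_apply_of_ne_of_ne hτo (ne_of_mem_of_not_mem hmem hiB),
      Perm.coe_inv, apply_symm_apply]

theorem rowCol_mul_swap_mul_symmetrizer {A B : Finset α} {o i : α} (hoA : o ∈ A) (hoB : o ∉ B)
    (hiA : i ∈ A) (hiB : i ∉ insert o B) :
    rowCol A (insert o B) * of ℚ _ (swap o i) * symmetrizer sign (insert o B) =
      (#B).factorial • rowCol A (insert o B) := by
  have hexpand (x : MonoidAlgebra ℚ (Perm α)) :
      rowCol A (insert o B) * of ℚ _ (swap o i) * x = ∑ τ ∈ permsOfFinset (insert o B),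
        sign τ • (symmetrizer 1 A * of ℚ _ (τ * swap o i) * x) := by
    simp_rw [rowCol, symmetrizer, twistedSum.eq_1 sign, mul_sum, sum_mul, mul_smul_comm,
      smul_mul_assoc, map_mul, mul_assoc]
  rw [hexpand, ← card_perms_of_finset, ← sum_const]
  rw [← sum_subset (permsOfFinset_mono (subset_insert o B)) fun τ hτ hτB => by
    rw [symmetrizer_mul_of_mul_swap_mul_symmetrizer_eq_zero hoA hiA hiB hτ hτB, smul_zero]]
  refine sum_congr rfl fun τ hτ => ?_
  rw [symmetrizer_mul_of_mul_swap_mul_symmetrizer hoA hoB hiA (notMem_mono (subset_insert o B) hiB)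
    (subset_insert o B) hτ, smul_smul, Int.units_mul_self, one_smul, rowCol]

theorem rowCol_insert_mul_self {A B : Finset α} {o : α} (hoA : o ∉ A) (hoB : o ∉ B)
    (hAB : _root_.Disjoint A B) :
    rowCol (insert o A) (insert o B) * rowCol (insert o A) (insert o B) =
      ((#A + #B + 1) * ((#B).factorial * (#A).factorial)) • rowCol (insert o A) (insert o B) := by
  have hcomm : Commute (symmetrizer 1 A) (symmetrizer sign (insert o B)) :=
    commute_symmetrizer 1 sign (by simp [hAB, hoA])
  have hcorner : rowCol (insert o A) (insert o B) * symmetrizer sign (insert o B) =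
      ((#B + 1) * (#B).factorial) • rowCol (insert o A) (insert o B) := by
    rw [rowCol, mul_assoc, symmetrizer_mul_symmetrizer sign subset_rfl, card_insert_of_notMem hoB,
      Nat.factorial_succ, mul_smul_comm]
  have hstar : rowCol (insert o A) (insert o B) * starSum 1 o A * symmetrizer sign (insert o B) =
      (#A * (#B).factorial) • rowCol (insert o A) (insert o B) := by
    rw [starSum, mul_sum, sum_mul, mul_smul, ← sum_const]
    refine sum_congr rfl fun i hi => ?_
    rw [MonoidHom.one_apply, one_smul]
    exact rowCol_mul_swap_mul_symmetrizer (mem_insert_self o A) hoB (mem_insert_of_mem hi)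
      (by simp [disjoint_left.1 hAB hi, ne_of_mem_of_not_mem hi hoA])
  have hrow : rowCol (insert o A) (insert o B) * symmetrizer 1 A =
      (#A).factorial • rowCol (insert o A) (insert o B) := by
    rw [rowCol, mul_assoc, ← hcomm.eq, ← mul_assoc,
      symmetrizer_mul_symmetrizer 1 (subset_insert o A), smul_mul_assoc]
  calc rowCol (insert o A) (insert o B) * rowCol (insert o A) (insert o B)
      = rowCol (insert o A) (insert o B) * (1 + starSum 1 o A) *
          symmetrizer sign (insert o B) * symmetrizer 1 A := by
        rw [mul_assoc _ (symmetrizer sign (insert o B)), ← hcomm.eq, ← starSum_insert_self 1 hoA,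
          mul_assoc _ (starSum _ _ _), ← mul_assoc (starSum _ _ _),
          ← symmetrizer_insert_left 1 hoA, ← rowCol]
    _ = ((#A + #B + 1) * ((#B).factorial * (#A).factorial)) •
          rowCol (insert o A) (insert o B) := by
        rw [mul_add, mul_one, add_mul, hcorner, hstar, ← add_smul, smul_mul_assoc, hrow, smul_smul]
        congr 1
        ring

end Symmetrizer

section PermMatrix

open Polynomial Matrix

theorem eq_one_or_eq_of_isCycle {α : Type*} [Finite α] {σ τ : Perm α} (hσ : σ.IsCycle)
    (h : ∀ i, τ i = i ∨ τ i = σ i) : τ = 1 ∨ τ = σ := by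
  refine or_iff_not_imp_left.2 fun hτ => ?_
  obtain ⟨i, hi⟩ : ∃ i, τ i ≠ i := by simpa [Equiv.ext_iff] using hτ
  have hstep (j : α) (hj : τ j ≠ j) : τ (σ j) ≠ σ j := fun h' => by
    have hτj := (h j).resolve_left hj
    exact hj (hτj.trans (τ.injective (h'.trans hτj.symm)))
  have hmoved (k : ℕ) : τ ((σ ^ k) i) ≠ (σ ^ k) i := by
    induction k with
    | zero => exact hi
    | succ k ih => rw [pow_succ', Perm.mul_apply]; exact hstep _ ih
  ext1 j
  by_cases hj : σ j = j
  · rcases h j with h' | h'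
    · rw [h', hj]
    · exact h'
  · have hσi : σ i ≠ i := fun h' => hi ((h i).elim id fun h'' => h''.trans h')
    obtain ⟨k, rfl⟩ := (hσ.sameCycle hσi hj).exists_nat_pow_eq
    exact (h _).resolve_left (hmoved k)

variable {α R : Type*} [DecidableEq α] [CommRing R]

theorem permMatrix_add_of_disjoint {σ τ : Perm α} (h : Perm.Disjoint σ τ) :
    σ.permMatrix R + τ.permMatrix R = 1 + (τ * σ).permMatrix R := by
  ext i j
  simp only [Matrix.add_apply, Matrix.one_apply, Perm.permMatrix, PEquiv.toMatrix_apply,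
    Equiv.toPEquiv_apply, Option.mem_some_iff, Perm.mul_apply]
  rcases h.symm i with hi | hi
  · rcases h.symm (σ i) with h' | h'
    · rw [hi, h', add_comm]
    · rw [σ.injective h', hi]
  · rw [hi]

variable [Fintype α]

theorem charpolyRev_permMatrix_mul_of_disjoint {σ τ : Perm α} (h : Perm.Disjoint σ τ) :
    (σ.permMatrix R).charpolyRev * (τ.permMatrix R).charpolyRev =
      (1 - X) ^ Fintype.card α * ((σ * τ).permMatrix R).charpolyRev := by
  have hadd : (X : R[X]) • (σ.permMatrix R).map C + (X : R[X]) • (τ.permMatrix R).map C =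
      (X : R[X]) • 1 + (X : R[X]) • ((τ * σ).permMatrix R).map C := by
    rw [← smul_add, ← smul_add, ← Matrix.map_add C (map_add C), permMatrix_add_of_disjoint h,
      Matrix.map_add C (map_add C), Matrix.map_one C (map_zero C) (map_one C)]
  rw [charpolyRev, charpolyRev, charpolyRev, ← det_mul, ← det_smul, h.commute.eq]
  congr 1
  rw [sub_mul, mul_sub, mul_sub, one_mul, mul_one, one_mul, smul_mul_smul_comm, ← Matrix.map_mul,
    ← permMatrix_mul]
  linear_combination (norm := module) (-1 : R[X]) • hadd

theorem charpolyRev_permMatrix_eq_sum (σ : Perm α) :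
    (σ.permMatrix R).charpolyRev = ∑ τ : Perm α, ((sign τ : ℤ) : R[X]) *
      ∏ i, ((if τ i = i then 1 else 0) - if τ i = σ i then X else 0) := by
  rw [charpolyRev, ← det_transpose, det_apply']
  refine sum_congr rfl fun τ _ => congrArg _ (prod_congr rfl fun i _ => ?_)
  simp [Matrix.one_apply, PEquiv.toMatrix_apply, eq_comm]

theorem charpolyRev_permMatrix_of_isCycle {σ : Perm α} (hσ : σ.IsCycle) :
    (σ.permMatrix R).charpolyRev =
      (1 - X ^ #σ.support) * (1 - X) ^ (Fintype.card α - #σ.support) := by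
  have hprod (a : R[X]) : (∏ i, if σ i = i then 1 - X else a) =
      (1 - X) ^ (Fintype.card α - #σ.support) * a ^ #σ.support := by
    rw [prod_ite, prod_const, prod_const, ← card_compl]
    congr 3
    simp [Perm.support, filter_not, compl_eq_univ_sdiff]
  have hone : (∏ i, ((if (1 : Perm α) i = i then 1 else 0) -
      if (1 : Perm α) i = σ i then (X : R[X]) else 0)) = ∏ i, if σ i = i then 1 - X else 1 :=
    prod_congr rfl fun i _ => by by_cases hi : σ i = i <;> simp [hi, Ne.symm]
  have hself : (∏ i, ((if σ i = i then 1 else 0) - if σ i = σ i then (X : R[X]) else 0)) =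
      ∏ i, if σ i = i then 1 - X else -X :=
    prod_congr rfl fun i _ => by by_cases hi : σ i = i <;> simp [hi]
  rw [charpolyRev_permMatrix_eq_sum, ← sum_subset (subset_univ {1, σ}),
    sum_pair hσ.ne_one.symm, hone, hself, hprod, hprod, hσ.sign, map_one, neg_pow (X : R[X])]
  · have hsq : ((-1 : R[X]) ^ #σ.support) * (-1) ^ #σ.support = 1 := by rw [← mul_pow]; simp
    push_cast
    linear_combination -(1 - X) ^ (Fintype.card α - #σ.support) * X ^ #σ.support * hsq
  · intro τ _ hτ
    obtain ⟨i, hi⟩ : ∃ i, ¬ (τ i = i ∨ τ i = σ i) := by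
      by_contra! h
      simpa using hτ (by simpa using eq_one_or_eq_of_isCycle hσ h)
    rw [prod_eq_zero (mem_univ i) (by simp [not_or.1 hi]), mul_zero]

theorem charpolyRev_permMatrix (σ : Perm α) :
    (σ.permMatrix R).charpolyRev = (σ.partition.parts.map fun c => 1 - (X : R[X]) ^ c).prod := by
  rw [parts_partition, Multiset.map_add, Multiset.prod_add, Multiset.map_replicate,
    Multiset.prod_replicate, pow_one]
  induction σ using cycle_induction_on with
  | base_one =>
    have hone : (1 : Matrix α α R[X]) - (X : R[X]) • 1 = (1 - X : R[X]) • 1 := by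
      rw [sub_smul, one_smul]
    simp [charpolyRev, Matrix.map_one C (map_zero C) (map_one C), hone]
  | base_cycles σ hσ => simp [charpolyRev_permMatrix_of_isCycle hσ, hσ.cycleType]
  | induction_disjoint σ τ h _ hσ hτ =>
    have hreg : IsRegular ((1 - X : R[X]) ^ Fintype.card α) := by
      rw [← neg_sub, neg_pow]
      exact (isUnit_one.neg.pow _).isRegular.mul ((monic_X_sub_C (1 : R)).isRegular.pow _)
    have hcard : #σ.support + #τ.support ≤ Fintype.card α := by
      rw [← h.card_support_mul]
      exact card_le_univ _
    refine hreg.left ?_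
    simp only
    rw [← charpolyRev_permMatrix_mul_of_disjoint h, hσ, hτ, h.cycleType_mul, Multiset.map_add,
      Multiset.prod_add, h.card_support_mul, mul_mul_mul_comm, ← pow_add, mul_left_comm, ← pow_add]
    congr 2
    omega

theorem coeff_rowCol (A B : Finset α) (σ : Perm α) :
    (rowCol A B).coeff σ =
      ∑ τ ∈ permsOfFinset B with σ * τ⁻¹ ∈ permsOfFinset A, ((sign τ : ℤ) : ℚ) := by
  simp only [rowCol, symmetrizer, twistedSum, sum_mul_sum, MonoidHom.one_apply, one_smul,
    Units.smul_def, mul_smul_comm, MonoidAlgebra.coeff_sum,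
    Finsupp.finsetSum_apply, MonoidAlgebra.coeff_smul_apply, MonoidAlgebra.of_apply,
    MonoidAlgebra.single_mul_single, MonoidAlgebra.coeff_single, Finsupp.single_apply,
    ← eq_mul_inv_iff_mul_eq, mul_one]
  rw [sum_comm, sum_filter]
  exact sum_congr rfl fun τ _ => by simp

theorem mem_permsOfFinset_and_mul_inv_mem_compl_iff {S : Finset α} {σ τ : Perm α} :
    τ ∈ permsOfFinset S ∧ σ * τ⁻¹ ∈ permsOfFinset Sᶜ ↔
      ∀ i, if i ∈ S then σ i = τ i else i = τ i := by
  constructor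
  · rintro ⟨hτ, hσ⟩ i
    split_ifs with hi
    · simpa using mem_permsOfFinset.1 hσ (τ i)
        (by simpa using (apply_mem_iff_of_mem_permsOfFinset hτ).2 hi)
    · exact (mem_permsOfFinset.1 hτ i hi).symm
  · intro h
    have hτ : τ ∈ permsOfFinset S :=
      mem_permsOfFinset.2 fun i hi => by simpa [hi, eq_comm] using h i
    refine ⟨hτ, mem_permsOfFinset.2 fun i hi => ?_⟩
    have hi' := (apply_mem_iff_of_mem_permsOfFinset (inv_mem_permsOfFinset hτ)).2
      (by simpa using hi)
    have h' := h (τ⁻¹ i)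
    rw [if_pos hi'] at h'
    simpa using h'

theorem coeff_rowCol_compl (S : Finset α) (σ : Perm α) :
    (rowCol Sᶜ S).coeff σ =
      ((σ.permMatrix ℚ).submatrix (Subtype.val : S → α) (Subtype.val : S → α)).det := by
  have hentry (τ : Perm α) (i : α) :
      (Matrix.of (S.piecewise (σ.permMatrix ℚ) (1 : Matrix α α ℚ)))ᵀ (τ i) i =
        if (if i ∈ S then σ i = τ i else i = τ i) then 1 else 0 := by
    by_cases hi : i ∈ S <;> simp [hi, Finset.piecewise, PEquiv.toMatrix_apply, Matrix.one_apply]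
  have hdet : ((σ.permMatrix ℚ).submatrix (Subtype.val : S → α) (Subtype.val : S → α)).det =
      ∑ τ : Perm α, ((sign τ : ℤ) : ℚ) *
        ∏ i, if (if i ∈ S then σ i = τ i else i = τ i) then 1 else 0 := by
    rw [← det_piecewise_one_eq_submatrix_det, ← det_transpose, det_apply']
    exact sum_congr rfl fun τ _ => congrArg _ (prod_congr rfl fun i _ => hentry τ i)
  simp only [hdet, coeff_rowCol, prod_ite_zero, prod_const_one, mul_ite, mul_one, mul_zero,
    mem_univ, true_imp_iff, ← mem_permsOfFinset_and_mul_inv_mem_compl_iff]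
  rw [← sum_filter]
  congr 1
  ext τ
  simp

theorem coeff_charpolyRev_permMatrix (σ : Perm α) (k : ℕ) :
    (σ.permMatrix ℚ).charpolyRev.coeff k =
      (-1) ^ k * ∑ S ∈ univ.powersetCard k, (rowCol Sᶜ S).coeff σ := by
  have h : (σ.permMatrix ℚ).charpolyRev = det (1 + (X : ℚ[X]) • (-σ.permMatrix ℚ).map C) := by
    rw [charpolyRev, Matrix.map_neg C (map_neg C), smul_neg, sub_eq_add_neg]
  rw [h, coeff_det_one_add_X_smul_eq_sum_minors, mul_sum]
  refine sum_congr rfl fun S hS => ?_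
  rw [coeff_rowCol_compl, ← (mem_powersetCard.1 hS).2, ← Fintype.card_coe, ← det_neg]
  rfl

end PermMatrix

section ConjTrace

open Polynomial

/-- The trace of `y ↦ g y x` on the rational group algebra, as a function of `x`. -/
noncomputable def conjTrace {G : Type*} [Group G] (g : G) : MonoidAlgebra ℚ G →ₗ[ℚ] ℚ :=
  LinearMap.trace ℚ _ ∘ₗ LinearMap.mulLeft ℚ (LinearMap.mulLeft ℚ (of ℚ G g)) ∘ₗ
    (LinearMap.mul ℚ (MonoidAlgebra ℚ G)).flip

section Group

variable {G : Type*} [Group G] (g : G)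

theorem conjTrace_apply (x : MonoidAlgebra ℚ G) :
    conjTrace g x =
      LinearMap.trace ℚ _ (LinearMap.mulLeft ℚ (of ℚ G g) * LinearMap.mulRight ℚ x) :=
  rfl

theorem conjTrace_mul_comm (x y : MonoidAlgebra ℚ G) :
    conjTrace g (x * y) = conjTrace g (y * x) := by
  have h (u v : MonoidAlgebra ℚ G) :
      LinearMap.mulRight ℚ (u * v) = LinearMap.mulRight ℚ v * LinearMap.mulRight ℚ u :=
    LinearMap.mulRight_mul ..
  rw [conjTrace_apply, conjTrace_apply, h, h, ← mul_assoc, LinearMap.trace_mul_comm, ← mul_assoc,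
    ← mul_assoc, (LinearMap.commute_mulLeft_right (of ℚ G g) x).eq]

theorem conjTrace_eq_of_semiconjBy {h : G} {x y : MonoidAlgebra ℚ G}
    (hxy : SemiconjBy (of ℚ G h) x y) : conjTrace g x = conjTrace g y := by
  have hinv : of ℚ G h⁻¹ * of ℚ G h = 1 := by rw [← map_mul, inv_mul_cancel, map_one]
  rw [← one_mul x, ← hinv, mul_assoc, hxy.eq, conjTrace_mul_comm, mul_assoc, ← map_mul,
    mul_inv_cancel, map_one, mul_one]

theorem conjTrace_eq_sum [Fintype G] (x : MonoidAlgebra ℚ G) :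
    conjTrace g x = ∑ h : G, x.coeff (h⁻¹ * g⁻¹ * h) := by
  classical
  rw [conjTrace_apply, LinearMap.trace_eq_matrix_trace ℚ (MonoidAlgebra.basis G ℚ), Matrix.trace]
  refine sum_congr rfl fun h _ => ?_
  rw [Matrix.diag_apply, LinearMap.toMatrix_apply]
  change (of ℚ G g * (MonoidAlgebra.basis G ℚ h * x)).coeff h = _
  rw [MonoidAlgebra.basis_apply, MonoidAlgebra.of_apply, MonoidAlgebra.coeff_single_mul_apply,
    MonoidAlgebra.coeff_single_mul_apply, one_mul, one_mul, mul_assoc]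

end Group

theorem exists_perm_map_eq {α : Type*} [Finite α] {B S : Finset α} (h : #B = #S) :
    ∃ σ : Perm α, B.map σ.toEmbedding = S := by
  classical
  let e : {x // x ∈ B} ≃ {x // x ∈ S} := Finset.equivOfCardEq h
  refine ⟨e.extendSubtype, eq_of_subset_of_card_le (fun x hx => ?_) (by rw [card_map, h])⟩
  obtain ⟨y, hy, rfl⟩ := mem_map.1 hx
  exact e.extendSubtype_mem y hy

variable {α : Type*} [DecidableEq α]

theorem semiconjBy_symmetrizer (ε : Perm α →* ℤˣ) (X : Finset α) (σ : Perm α) :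
    SemiconjBy (of ℚ _ σ) (symmetrizer ε X) (symmetrizer ε (X.map σ.toEmbedding)) := by
  refine semiconjBy_twistedSum ε fun τ => ?_
  simp only [mem_permsOfFinset, mem_map_equiv, Perm.mul_apply]
  exact ⟨fun h i hi => by simpa using h (σ i) (by simpa using hi),
    fun h i hi => by simpa using congrArg σ (h _ hi)⟩

theorem starSum_sign [Fintype α] {o : α} {X : Finset α} (ho : o ∉ X) :
    starSum sign o X = -starSum 1 o X := by
  rw [starSum, starSum, ← sum_neg_distrib]
  refine sum_congr rfl fun i hi => ?_
  rw [sign_swap (ne_of_mem_of_not_mem hi ho).symm, MonoidHom.one_apply, one_smul, Units.neg_smul,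
    one_smul]

variable [Fintype α] {A B : Finset α}

theorem conjTrace_rowCol_compl_congr (g : Perm α) {S : Finset α} (h : #S = #B) :
    conjTrace g (rowCol Sᶜ S) = conjTrace g (rowCol Bᶜ B) := by
  obtain ⟨σ, rfl⟩ := exists_perm_map_eq h
  have hcompl : (S.map σ.toEmbedding)ᶜ = Sᶜ.map σ.toEmbedding := by ext; simp
  rw [hcompl]
  exact conjTrace_eq_of_semiconjBy g
    ((semiconjBy_symmetrizer 1 Sᶜ σ).mul_right (semiconjBy_symmetrizer sign S σ))

theorem charpolyRev_permMatrix_conj (g h : Perm α) :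
    ((h⁻¹ * g⁻¹ * h).permMatrix ℚ).charpolyRev = (g.permMatrix ℚ).charpolyRev := by
  have hconj : IsConj (h⁻¹ * g⁻¹ * h) g := by
    rw [isConj_iff_cycleType_eq, ← cycleType_inv g, ← cycleType_conj (σ := g⁻¹) (τ := h⁻¹), inv_inv]
  rw [charpolyRev_permMatrix, charpolyRev_permMatrix, partition_eq_of_isConj.1 hconj]

theorem conjTrace_rowCol_compl (g : Perm α) (B : Finset α) :
    conjTrace g (rowCol Bᶜ B) = ((#B).factorial * (Fintype.card α - #B).factorial : ℕ) *
      ((-1) ^ #B * (g.permMatrix ℚ).charpolyRev.coeff #B) := by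
  have hsum : ∑ S ∈ univ.powersetCard #B, conjTrace g (rowCol Sᶜ S) =
      (Fintype.card α).factorial * ((-1) ^ #B * (g.permMatrix ℚ).charpolyRev.coeff #B) := by
    have hcoeff (h : Perm α) :
        ∑ S ∈ univ.powersetCard #B, (rowCol Sᶜ S).coeff (h⁻¹ * g⁻¹ * h) =
          (-1) ^ #B * (g.permMatrix ℚ).charpolyRev.coeff #B := by
      rw [← charpolyRev_permMatrix_conj g h, coeff_charpolyRev_permMatrix, ← mul_assoc, ← mul_pow]
      simp
    simp only [conjTrace_eq_sum]
    rw [sum_comm, sum_congr rfl fun h _ => hcoeff h, sum_const, nsmul_eq_mul, card_univ,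
      Fintype.card_perm]
  rw [sum_congr rfl fun S hS => conjTrace_rowCol_compl_congr g (mem_powersetCard.1 hS).2,
    sum_const, card_powersetCard, card_univ, nsmul_eq_mul,
    ← Nat.choose_mul_factorial_mul_factorial (card_le_univ B)] at hsum
  have hchoose : ((Fintype.card α).choose #B : ℚ) ≠ 0 :=
    mod_cast (Nat.choose_pos (card_le_univ B)).ne'
  refine mul_left_cancel₀ hchoose (hsum.trans ?_)
  push_cast
  ring

theorem commute_of_rowCol_of_mem_left (hAB : _root_.Disjoint A B) {σ : Perm α}
    (hσ : σ ∈ permsOfFinset A) : Commute (of ℚ _ σ) (rowCol A B) := by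
  refine Commute.mul_right ?_ (commute_of_symmetrizer sign hAB hσ)
  rw [commute_iff_eq, of_mul_symmetrizer 1 hσ, symmetrizer_mul_of 1 hσ]

theorem commute_of_rowCol_of_mem_right (hAB : _root_.Disjoint A B) {σ : Perm α}
    (hσ : σ ∈ permsOfFinset B) : Commute (of ℚ _ σ) (rowCol A B) := by
  refine (commute_of_symmetrizer 1 hAB.symm hσ).mul_right ?_
  rw [commute_iff_eq, of_mul_symmetrizer sign hσ, symmetrizer_mul_of sign hσ]

theorem conjTrace_rowCol_mul_swap_congr (g : Perm α) (hAB : _root_.Disjoint A B) {i i' j j' : α}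
    (hi : i ∈ A) (hi' : i' ∈ A) (hj : j ∈ B) (hj' : j' ∈ B) :
    conjTrace g (rowCol A B * of ℚ _ (swap i j)) =
      conjTrace g (rowCol A B * of ℚ _ (swap i' j')) := by
  set σ := swap i i' * swap j j' with hσ
  have hcomm : Commute (of ℚ _ σ) (rowCol A B) := by
    rw [hσ, map_mul]
    exact (commute_of_rowCol_of_mem_left hAB (swap_mem_permsOfFinset hi hi')).mul_left
      (commute_of_rowCol_of_mem_right hAB (swap_mem_permsOfFinset hj hj'))
  have hσi : σ i = i' := by
    rw [hσ, Perm.mul_apply, swap_apply_of_ne_of_ne (disjoint_iff_ne.1 hAB i hi j hj)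
      (disjoint_iff_ne.1 hAB i hi j' hj'), swap_apply_left]
  have hσj : σ j = j' := by
    rw [hσ, Perm.mul_apply, swap_apply_left, swap_apply_of_ne_of_ne
      (disjoint_iff_ne.1 hAB i hi j' hj').symm (disjoint_iff_ne.1 hAB i' hi' j' hj').symm]
  have hswap : SemiconjBy σ (swap i j) (swap i' j') := by
    rw [SemiconjBy, mul_swap_eq_swap_mul, hσi, hσj]
  exact conjTrace_eq_of_semiconjBy g (SemiconjBy.mul_right hcomm (hswap.map (of ℚ _)))

theorem conjTrace_rowCol_insert_right (g : Perm α) {o : α} (ho : o ∉ B) :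
    conjTrace g (rowCol A (insert o B)) = conjTrace g (rowCol A B) -
      ∑ j ∈ B, conjTrace g (rowCol A B * of ℚ _ (swap o j)) := by
  have hcomm : Commute (symmetrizer sign B) (starSum 1 o B) :=
    commute_twistedSum_left fun _ hσ => commute_of_starSum 1 ho hσ
  rw [rowCol, symmetrizer_insert_left sign ho, starSum_insert_self sign ho, starSum_sign ho,
    ← sub_eq_add_neg, sub_mul, one_mul, ← hcomm.eq, mul_sub, ← mul_assoc, ← rowCol, map_sub,
    starSum, mul_sum, map_sum]
  simp only [MonoidHom.one_apply, one_smul]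

theorem conjTrace_rowCol_insert_left (g : Perm α) {o : α} (ho : o ∉ A) :
    conjTrace g (rowCol (insert o A) B) = conjTrace g (rowCol A B) +
      ∑ i ∈ A, conjTrace g (rowCol A B * of ℚ _ (swap o i)) := by
  rw [rowCol, symmetrizer_insert_left 1 ho, starSum_insert_self 1 ho, mul_assoc,
    conjTrace_mul_comm, ← rowCol, mul_add, mul_one, map_add, starSum, mul_sum, map_sum]
  simp only [MonoidHom.one_apply, one_smul]

theorem conjTrace_hook_add_hook (g : Perm α) (hAB : _root_.Disjoint A B) {o j : α} (ho : o ∈ A)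
    (hj : j ∈ B) :
    #A * conjTrace g (rowCol A (insert o B)) + #B * conjTrace g (rowCol (insert j A) B) =
      (#A + #B) * conjTrace g (rowCol A B) := by
  set t := conjTrace g (rowCol A B * of ℚ _ (swap o j))
  have hright : ∑ j' ∈ B, conjTrace g (rowCol A B * of ℚ _ (swap o j')) = #B * t := by
    rw [← nsmul_eq_mul, ← sum_const]
    exact sum_congr rfl fun j' hj' => conjTrace_rowCol_mul_swap_congr g hAB ho ho hj' hj
  have hleft : ∑ i ∈ A, conjTrace g (rowCol A B * of ℚ _ (swap j i)) = #A * t := by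
    rw [← nsmul_eq_mul, ← sum_const]
    refine sum_congr rfl fun i hi => ?_
    rw [swap_comm, conjTrace_rowCol_mul_swap_congr g hAB hi ho hj hj]
  rw [conjTrace_rowCol_insert_right g (disjoint_left.1 hAB ho),
    conjTrace_rowCol_insert_left g (disjoint_right.1 hAB hj), hright, hleft]
  ring

theorem conjTrace_hook (g : Perm α) {Y : ℚ[X]} (hY : (1 - X) * Y = (g.permMatrix ℚ).charpolyRev)
    {B : Finset α} {o : α} (ho : o ∉ B) :
    conjTrace g (rowCol Bᶜ (insert o B)) =
      (Fintype.card α * ((#B).factorial * (Fintype.card α - #B - 1).factorial) : ℕ) *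
        ((-1) ^ #B * Y.coeff #B) := by
  induction B using Finset.induction_on generalizing o with
  | empty =>
    obtain ⟨m, hm⟩ := Nat.exists_eq_succ_of_ne_zero (card_lt_univ_of_notMem ho).ne_bot
    rw [conjTrace_rowCol_insert_right g ho, sum_empty, sub_zero, conjTrace_rowCol_compl, ← hY]
    simp [sub_mul, hm, Nat.factorial_succ]
  | insert j B hj ih =>
    have hrec := conjTrace_hook_add_hook g (disjoint_compl_left (a := insert j B))
      (mem_compl.2 ho) (mem_insert_self j B)
    obtain ⟨m, hm⟩ := Nat.exists_eq_add_of_lt (card_lt_univ_of_notMem ho)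
    rw [card_insert_of_notMem hj] at hm ⊢
    rw [insert_compl_insert hj, ih hj, conjTrace_rowCol_compl, ← hY, card_compl,
      card_insert_of_notMem hj, hm, sub_mul, one_mul, Polynomial.coeff_sub,
      Polynomial.coeff_X_mul] at hrec
    rw [hm]
    have hm0 : ((m + 1 : ℕ) : ℚ) ≠ 0 := by exact_mod_cast m.succ_ne_zero
    refine mul_left_cancel₀ hm0 ?_
    have hsub_add : #B + 1 + m + 1 - (#B + 1) = m + 1 := by omega
    have hsub_one : #B + 1 + m + 1 - #B - 1 = m + 1 := by omega
    rw [hsub_add, hsub_one] at hrec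
    rw [hsub_add, Nat.add_sub_cancel]
    push_cast [Nat.factorial_succ, pow_succ] at hrec ⊢
    linear_combination hrec

end ConjTrace

section Characters

open Polynomial

variable {d : ℕ} {lam : d.Partition}

theorem character_spechtRep {m : ℚ} (hm : m ≠ 0)
    (h : youngSymmetrizer (tableau lam) * youngSymmetrizer (tableau lam) =
      m • youngSymmetrizer (tableau lam)) (g : Perm (Fin d)) :
    (spechtRep lam).character g = m⁻¹ * conjTrace g (youngSymmetrizer (tableau lam)) := by
  set y := youngSymmetrizer (tableau lam)
  let p : Submodule ℚ (MonoidAlgebra ℚ (Perm (Fin d))) := (spechtModule lam).restrictScalars ℚ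
  let f : Module.End ℚ (MonoidAlgebra ℚ (Perm (Fin d))) :=
    m⁻¹ • (LinearMap.mulLeft ℚ (of ℚ _ g) * LinearMap.mulRight ℚ y)
  have hfp (x) : f x ∈ p := by
    refine p.smul_mem _ ?_
    change _ ∈ Submodule.span _ {y}
    exact Submodule.mem_span_singleton.2 ⟨of ℚ _ g * x, mul_assoc _ _ _⟩
  have hrestrict : f.restrict (fun x _ => hfp x) =
      (((spechtModule lam).restrictScalarsEquiv ℚ _ _).symm.restrictScalars ℚ).conj
        (spechtRep lam g) := by
    refine LinearMap.ext fun ⟨x, hx⟩ => Subtype.ext ?_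
    obtain ⟨z, rfl⟩ := Submodule.mem_span_singleton.1 hx
    change m⁻¹ • (of ℚ _ g * (z * y * y)) = of ℚ _ g * (z * y)
    rw [mul_assoc z, h, mul_smul_comm, mul_smul_comm, inv_smul_smul₀ hm]
  have htrace := LinearMap.trace_restrict_eq_of_forall_mem p f hfp
  rw [hrestrict, LinearMap.trace_conj'] at htrace
  exact htrace.trans (by rw [conjTrace_apply, map_smul, smul_eq_mul])

theorem youngSymmetrizer_eq_twistedSum (T : Tableau lam) :
    youngSymmetrizer T = twistedSum 1 (rowStabilizer T) * twistedSum sign (colStabilizer T) := by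
  simp [youngSymmetrizer, twistedSum, Units.smul_def, Int.cast_smul_eq_zsmul]

/-- A partition is a hook if its diagram does not contain the second diagonal cell. -/
def IsHook (lam : d.Partition) : Prop := (1, 1) ∉ diagram lam

/-- The numbers in the first row of a tableau. -/
def firstRow (T : Tableau lam) : Finset (Fin d) := {i | (T.symm i).1.1 = 0}

/-- The numbers in the first column of a tableau. -/
def firstCol (T : Tableau lam) : Finset (Fin d) := {i | (T.symm i).1.2 = 0}

theorem IsHook.fst_eq_zero_or_snd_eq_zero (h : IsHook lam) (c : (diagram lam).cells) :
    c.1.1 = 0 ∨ c.1.2 = 0 := by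
  by_contra! hc
  exact h ((diagram lam).up_left_mem (Nat.one_le_iff_ne_zero.2 hc.1)
    (Nat.one_le_iff_ne_zero.2 hc.2) c.2)

theorem forall_apply_eq_iff_mem_permsOfFinset {α : Type*} [Fintype α] [DecidableEq α]
    {u v : α → ℕ} (huv : ∀ i j, u i = u j → v i = v j → i = j) (h : ∀ i, u i = 0 ∨ v i = 0)
    (σ : Perm α) : (∀ i, u (σ i) = u i) ↔ σ ∈ permsOfFinset {i | u i = 0} := by
  constructor
  · intro hσ
    refine mem_permsOfFinset.2 fun i hi => huv _ _ (hσ i) ?_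
    have hui : u i ≠ 0 := by simpa using hi
    rw [(h i).resolve_left hui, (h (σ i)).resolve_left (by rwa [hσ i])]
  · intro hσ i
    by_cases hi : u i = 0
    · have := (apply_mem_iff_of_mem_permsOfFinset hσ (i := i)).2 (by simpa using hi)
      rw [hi]
      simpa using this
    · rw [mem_permsOfFinset.1 hσ i (by simpa using hi)]

theorem IsHook.youngSymmetrizer_eq_rowCol (h : IsHook lam) (T : Tableau lam) :
    youngSymmetrizer T = rowCol (firstRow T) (firstCol T) := by
  have hinj (i j : Fin d) (h₁ : (T.symm i).1.1 = (T.symm j).1.1)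
      (h₂ : (T.symm i).1.2 = (T.symm j).1.2) : i = j :=
    T.symm.injective (Subtype.ext (Prod.ext h₁ h₂))
  have hrow : rowStabilizer T = permsOfFinset (firstRow T) := by
    ext σ
    rw [rowStabilizer, mem_filter_univ, firstRow, ← forall_apply_eq_iff_mem_permsOfFinset hinj
      fun i => h.fst_eq_zero_or_snd_eq_zero (T.symm i)]
  have hcol : colStabilizer T = permsOfFinset (firstCol T) := by
    ext σ
    rw [colStabilizer, mem_filter_univ, firstCol, ← forall_apply_eq_iff_mem_permsOfFinset
      (fun i j h₂ h₁ => hinj i j h₁ h₂) fun i => (h.fst_eq_zero_or_snd_eq_zero (T.symm i)).symm]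
  rw [youngSymmetrizer_eq_twistedSum, hrow, hcol, rowCol, symmetrizer, symmetrizer]

theorem rowLens_diagram (lam : d.Partition) :
    (diagram lam).rowLens = lam.parts.sort (· ≥ ·) :=
  YoungDiagram.rowLens_ofRowLens_eq_self fun _ hx => lam.parts_pos ((Multiset.mem_sort _).1 hx)

theorem colLen_diagram_zero (lam : d.Partition) :
    (diagram lam).colLen 0 = Multiset.card lam.parts := by
  rw [← YoungDiagram.length_rowLens, rowLens_diagram, Multiset.length_sort]

theorem card_firstCol (T : Tableau lam) : #(firstCol T) = Multiset.card lam.parts := by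
  rw [← colLen_diagram_zero, YoungDiagram.colLen_eq_card]
  refine card_bij (fun i _ => (T.symm i).1) (fun i hi => ?_)
    (fun i _ j _ hij => T.symm.injective (Subtype.ext hij)) fun c hc => ?_
  · exact YoungDiagram.mem_col_iff.2 ⟨(T.symm i).2, by simpa [firstCol] using hi⟩
  · obtain ⟨hc, hc0⟩ := YoungDiagram.mem_col_iff.1 hc
    exact ⟨T ⟨c, hc⟩, by simp [firstCol, hc0], by simp⟩

theorem IsHook.exists_youngSymmetrizer_eq (hd : 0 < d) (h : IsHook lam) (T : Tableau lam) :
    ∃ (B : Finset (Fin d)) (o : Fin d), o ∉ B ∧ #B + 1 = Multiset.card lam.parts ∧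
      youngSymmetrizer T = rowCol Bᶜ (insert o B) := by
  obtain ⟨c, hc⟩ : (diagram lam).cells.Nonempty := card_pos.1 (by rwa [card_diagram])
  have hcorner : (0, 0) ∈ diagram lam :=
    (diagram lam).up_left_mem (Nat.zero_le c.1) (Nat.zero_le c.2) hc
  set o := T ⟨(0, 0), hcorner⟩ with ho
  have hoC : o ∈ firstCol T := by simp [firstCol, ho]
  have hrow : firstRow T = ((firstCol T).erase o)ᶜ := by
    ext i
    have hi : i = o ↔ (T.symm i).1.1 = 0 ∧ (T.symm i).1.2 = 0 := by
      rw [ho, ← T.symm_apply_eq, Subtype.ext_iff, Prod.ext_iff]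
    have := h.fst_eq_zero_or_snd_eq_zero (T.symm i)
    simp only [mem_compl, mem_erase, firstRow, firstCol, mem_filter_univ, ne_eq, hi]
    tauto
  refine ⟨(firstCol T).erase o, o, notMem_erase _ _, ?_, ?_⟩
  · rw [card_erase_add_one hoC, card_firstCol]
  · rw [insert_erase hoC, ← hrow, h.youngSymmetrizer_eq_rowCol]

theorem rowCol_hook_mul_self {α : Type*} [Fintype α] [DecidableEq α] {B : Finset α} {o : α}
    (ho : o ∉ B) :
    rowCol Bᶜ (insert o B) * rowCol Bᶜ (insert o B) =
      (Fintype.card α * ((#B).factorial * (Fintype.card α - #B - 1).factorial)) •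
        rowCol Bᶜ (insert o B) := by
  have h := rowCol_insert_mul_self (notMem_erase o Bᶜ) ho
    (disjoint_compl_left.mono_left (erase_subset o Bᶜ))
  have hcard := card_lt_univ_of_notMem ho
  rwa [insert_erase (mem_compl.2 ho), card_erase_of_mem (mem_compl.2 ho), card_compl,
    show Fintype.card α - #B - 1 + #B + 1 = Fintype.card α by omega] at h

theorem IsHook.chi_eq (hd : 0 < d) (h : IsHook lam) (mu : d.Partition) {Y : ℚ[X]}
    (hY : (1 - X) * Y = (mu.parts.map fun c => 1 - X ^ c).prod) :
    chi lam mu = (-1) ^ (Multiset.card lam.parts - 1) *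
      Y.coeff (Multiset.card lam.parts - 1) := by
  obtain ⟨B, o, ho, hB, hsymm⟩ := h.exists_youngSymmetrizer_eq hd (tableau lam)
  rw [chi, ← hB, Nat.add_sub_cancel]
  set g := (exists_perm_of_partition mu).choose
  have hYg : (1 - X) * Y = (g.permMatrix ℚ).charpolyRev := by
    rw [hY, charpolyRev_permMatrix, (exists_perm_of_partition mu).choose_spec]
  have hm : ((Fintype.card (Fin d) *
      ((#B).factorial * (Fintype.card (Fin d) - #B - 1).factorial) : ℕ) : ℚ) ≠ 0 := by
    rw [Fintype.card_fin]
    exact_mod_cast Nat.mul_ne_zero hd.ne'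
      (Nat.mul_ne_zero (Nat.factorial_ne_zero _) (Nat.factorial_ne_zero _))
  have hsq := rowCol_hook_mul_self ho
  rw [← hsymm, ← Nat.cast_smul_eq_nsmul ℚ] at hsq
  rw [character_spechtRep hm hsq, hsymm, conjTrace_hook g hYg ho, inv_mul_cancel_left₀ hm]

end Characters

section FullCycles

variable {α : Type*} {σ : Perm α}

theorem rel_of_sameCycle {r : α → α → Prop} (hr : Equivalence r) (h : ∀ l, r l (σ l)) {i j : α}
    (hij : σ.SameCycle i j) : r i j := by
  obtain ⟨k, rfl⟩ := hij
  induction k with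
  | zero => exact hr.refl i
  | succ n ih =>
    rw [add_comm, zpow_add, zpow_one, Perm.mul_apply]
    exact hr.trans ih (h _)
  | pred n ih =>
    have hstep := h ((σ ^ (-(n : ℤ) - 1)) i)
    rw [← Perm.mul_apply, ← zpow_one_add, add_sub_cancel] at hstep
    exact hr.trans ih (hr.symm hstep)

variable [DecidableEq α]

theorem sameCycle_swap_mul {a i j : α} (hi : i ≠ a) (hj : j ≠ a) :
    (swap a (σ a) * σ).SameCycle i j ↔ σ.SameCycle i j := by
  set τ := swap a (σ a) * σ with hτ
  have hτ_apply (l : α) : τ l = if σ l = a then σ a else if l = a then a else σ l := by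
    rw [hτ, Perm.mul_apply, swap_apply_def]
    simp only [σ.injective.eq_iff]
  constructor
  · refine rel_of_sameCycle (SameCycle.equivalence σ) fun l => ?_
    rw [hτ_apply]
    split_ifs with hla hl
    · rw [← hla, sameCycle_apply_right, sameCycle_apply_right]
    · rw [hl]
    · rw [sameCycle_apply_right]
  · intro hij
    let ρ (l : α) : α := if l = a then σ a else l
    have hτ_eq {l : α} (hl : l ≠ a) : τ l = ρ (σ l) := by
      rw [hτ_apply, if_neg hl]
    have := rel_of_sameCycle ((SameCycle.equivalence τ).comap ρ) (fun l => ?_) hij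
    · simpa [Function.onFun, ρ, hi, hj] using this
    · change τ.SameCycle (ρ l) (ρ (σ l))
      by_cases hl : l = a
      · by_cases ha : σ a = a <;> simp [ρ, hl, ha, SameCycle.refl]
      · rw [← hτ_eq hl, sameCycle_apply_right, show ρ l = l from if_neg hl]

open Classical in
/-- The permutations of `X` that consist of a single cycle through all points of `X`. -/
noncomputable def cyclesOn (X : Finset α) : Finset (Perm α) :=
  {σ ∈ permsOfFinset X | σ.IsCycleOn X}

theorem mem_cyclesOn {X : Finset α} :
    σ ∈ cyclesOn X ↔ σ ∈ permsOfFinset X ∧ ∀ i ∈ X, ∀ j ∈ X, σ.SameCycle i j := by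
  simp only [cyclesOn, mem_filter, and_congr_right_iff]
  exact fun hσ => ⟨fun h i hi j hj => h.2 hi hj, fun h =>
    ⟨σ.bijOn fun _ => apply_mem_iff_of_mem_permsOfFinset hσ, fun i hi j hj => h i hi j hj⟩⟩

theorem mem_cyclesOn_insert {o : α} {X : Finset α} (ho : o ∉ X) (hX : X.Nonempty) :
    σ ∈ cyclesOn (insert o X) ↔ σ o ∈ X ∧ swap o (σ o) * σ ∈ cyclesOn X := by
  have hne {i : α} (hi : i ∈ X) : i ≠ o := ne_of_mem_of_not_mem hi ho
  rw [mem_cyclesOn, mem_cyclesOn, mem_permsOfFinset_insert]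
  constructor
  · rintro ⟨⟨hσo, hσ⟩, hcycle⟩
    refine ⟨mem_of_mem_insert_of_ne hσo fun hfix => ?_, hσ, fun i hi j hj =>
      (sameCycle_swap_mul (hne hi) (hne hj)).2
        (hcycle i (mem_insert_of_mem hi) j (mem_insert_of_mem hj))⟩
    obtain ⟨x, hx⟩ := hX
    exact hne hx
      ((hcycle o (mem_insert_self o X) x (mem_insert_of_mem hx)).eq_of_left hfix).symm
  · rintro ⟨hσo, hσ, hcycle⟩
    refine ⟨⟨mem_insert_of_mem hσo, hσ⟩, ?_⟩
    have hbase : ∀ i ∈ insert o X, σ.SameCycle (σ o) i := by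
      refine forall_mem_insert _ _ _ |>.2 ⟨?_, fun i hi => ?_⟩
      · rw [sameCycle_apply_left]
      · exact (sameCycle_swap_mul (hne hσo) (hne hi)).1 (hcycle _ hσo i hi)
    exact fun i hi j hj => (hbase i hi).symm.trans (hbase j hj)

theorem twistedSum_cyclesOn_insert {o : α} {X : Finset α} (ho : o ∉ X) (hX : X.Nonempty) :
    twistedSum 1 (cyclesOn (insert o X)) = starSum 1 o X * twistedSum 1 (cyclesOn X) :=
  twistedSum_eq_starSum_mul 1 (fun _ hτ => mem_permsOfFinset.1 (mem_cyclesOn.1 hτ).1 o ho)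
    fun _ => mem_cyclesOn_insert ho hX

theorem twistedSum_cyclesOn_mul_eq_zero_of_subset {X Y : Finset α} (hX : X.Nonempty) (hXY : X ⊆ Y)
    {x : MonoidAlgebra ℚ (Perm α)} (h : twistedSum 1 (cyclesOn X) * x = 0) :
    twistedSum 1 (cyclesOn Y) * x = 0 := by
  obtain ⟨Z, rfl⟩ : ∃ Z, Y = Z ∪ X := ⟨Y, (union_eq_left.2 hXY).symm⟩
  clear hXY
  induction Z using Finset.induction_on with
  | empty => rwa [empty_union]
  | insert o Z _ ih =>
    rw [insert_union]
    by_cases ho : o ∈ Z ∪ X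
    · rwa [insert_eq_of_mem ho]
    · rw [twistedSum_cyclesOn_insert ho hX.inr, mul_assoc, ih, mul_zero]

theorem symmetrizer_singleton (ε : Perm α →* ℤˣ) (o : α) : symmetrizer ε {o} = 1 := by
  have : permsOfFinset {o} = {1} := by
    refine eq_singleton_iff_unique_mem.2 ⟨mem_permsOfFinset.2 fun _ _ => rfl, fun σ hσ => ?_⟩
    ext i
    by_cases hi : i ∈ ({o} : Finset α)
    · rw [mem_singleton.1 hi]
      exact mem_singleton.1 ((apply_mem_iff_of_mem_permsOfFinset hσ).2 (mem_singleton_self o))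
    · exact mem_permsOfFinset.1 hσ i hi
  rw [symmetrizer, twistedSum, this, sum_singleton, map_one, map_one, one_smul]

theorem symmetrizer_pair (ε : Perm α →* ℤˣ) {o i : α} (h : o ≠ i) :
    symmetrizer ε {o, i} = 1 + ε (swap o i) • of ℚ _ (swap o i) := by
  have ho : o ∉ ({i} : Finset α) := notMem_singleton.2 h
  rw [symmetrizer_insert_left ε ho, starSum_insert_self ε ho, symmetrizer_singleton, mul_one,
    starSum, sum_singleton]

variable [Fintype α]

/-- The Young symmetrizer of the square tableau with rows `p q` and `r s`. -/
noncomputable def squareSymmetrizer (p q r s : α) : MonoidAlgebra ℚ (Perm α) :=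
  symmetrizer 1 {p, q} * symmetrizer 1 {r, s} * (symmetrizer sign {p, r} * symmetrizer sign {q, s})

theorem starSum_mul_squareSymmetrizer {p q r s : α} (h : [p, q, r, s].Nodup) :
    starSum 1 s {p, q, r} * squareSymmetrizer p q r s = 0 := by
  simp only [List.nodup_cons, List.mem_cons, List.not_mem_nil, or_false, not_or,
    not_false_eq_true, List.nodup_nil, and_true] at h
  obtain ⟨⟨hpq, hpr, hps⟩, ⟨hqr, hqs⟩, hrs⟩ := h
  set a := symmetrizer (1 : Perm α →* ℤˣ) {p, q}
  set b := symmetrizer (1 : Perm α →* ℤˣ) {r, s} with hb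
  set u := symmetrizer (1 : Perm α →* ℤˣ) (insert s {p, q}) with hu
  set v := symmetrizer (sign : Perm α →* ℤˣ) {p, r}
  set w := symmetrizer (sign : Perm α →* ℤˣ) {q, s}
  have hab : Commute a b := commute_symmetrizer 1 1 (by simp [*, Ne.symm])
  have hvw : Commute v w := commute_symmetrizer sign sign (by simp [*, Ne.symm])
  have hswap : of ℚ _ (swap s r) * b = b := by
    rw [hb, of_mul_symmetrizer 1 (swap_mem_permsOfFinset (by simp) (by simp)),
      MonoidHom.one_apply, one_smul]
  have hsplit : starSum 1 s {p, q, r} * (a * b) = u * b := by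
    have hs : s ∉ ({p, q} : Finset α) := by simp [*, Ne.symm]
    have hr : r ∉ ({p, q} : Finset α) := by simp [*, Ne.symm]
    rw [show ({p, q, r} : Finset α) = insert r {p, q} by grind, starSum, sum_insert hr, ← starSum,
      MonoidHom.one_apply, one_smul, hu, symmetrizer_insert_left 1 hs, starSum_insert_self 1 hs,
      add_mul, add_mul, add_mul, one_mul, mul_assoc (starSum _ _ _), hab.eq, ← mul_assoc, hswap]
  have hw : u * w = 0 := by
    rw [← mul_one u, ← map_one (of ℚ (Perm α))]
    exact symmetrizer_mul_of_mul_symmetrizer_eq_zero hqs (by simp) (by simp) (by simp) (by simp)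
  have hv : u * of ℚ _ (swap r s) * v = 0 :=
    symmetrizer_mul_of_mul_symmetrizer_eq_zero hpr (by simp) (by simp)
      (by simp [swap_apply_of_ne_of_ne hpr hps]) (by simp)
  calc starSum 1 s {p, q, r} * squareSymmetrizer p q r s = u * b * (v * w) := by
        rw [squareSymmetrizer, ← mul_assoc, hsplit]
    _ = u * w * v + u * of ℚ _ (swap r s) * v * w := by
        rw [hb, symmetrizer_pair 1 hrs, MonoidHom.one_apply, one_smul, mul_add, mul_one, add_mul,
          hvw.eq]
        nth_rw 2 [← hvw.eq]
        simp only [mul_assoc]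
    _ = 0 := by rw [hw, hv, zero_mul, zero_mul, add_zero]

theorem twistedSum_cyclesOn_mul_squareSymmetrizer {p q r s : α} (h : [p, q, r, s].Nodup) :
    twistedSum 1 (cyclesOn univ) * squareSymmetrizer p q r s = 0 := by
  have hs : s ∉ ({p, q, r} : Finset α) := by
    simp only [List.nodup_cons, List.mem_cons] at h
    grind
  refine twistedSum_cyclesOn_mul_eq_zero_of_subset (insert_nonempty s {p, q, r})
    (subset_univ _) ?_
  have hcomm : Commute (twistedSum 1 (cyclesOn {p, q, r})) (starSum 1 s {p, q, r}) :=
    commute_twistedSum_left fun σ hσ => commute_of_starSum 1 hs (mem_cyclesOn.1 hσ).1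
  rw [twistedSum_cyclesOn_insert hs (insert_nonempty _ _), ← hcomm.eq, mul_assoc,
    starSum_mul_squareSymmetrizer h, mul_zero]

theorem parts_partition_of_mem_cyclesOn_univ [Nontrivial α] {σ : Perm α}
    (hσ : σ ∈ cyclesOn univ) : σ.partition.parts = {Fintype.card α} := by
  have hon : σ.IsCycleOn (univ : Finset α) := by
    simp only [cyclesOn, mem_filter] at hσ
    exact hσ.2
  have huniv : ((univ : Finset α) : Set α).Nontrivial := by simpa using Set.nontrivial_univ
  have hcycle : σ.IsCycle :=
    isCycle_iff_exists_isCycleOn.2 ⟨_, huniv, hon, fun x _ => mem_coe.2 (mem_univ x)⟩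
  have hsupp : σ.support = univ :=
    eq_univ_iff_forall.2 fun i => mem_support.2 (hon.apply_ne huniv (mem_coe.2 (mem_univ i)))
  rw [parts_partition, hcycle.cycleType, hsupp, card_univ, Nat.sub_self, Multiset.replicate_zero,
    add_zero]

theorem cyclesOn_univ_nonempty : (cyclesOn (univ : Finset α)).Nonempty := by
  obtain ⟨σ, hσ, -⟩ := exists_cycleOn (univ : Finset α)
  exact ⟨σ, by simpa [cyclesOn, mem_permsOfFinset] using hσ⟩

end FullCycles

section NonHooks

variable {d : ℕ} {lam : d.Partition}

theorem apply_eq_of_mem_permsOfFinset_pair {α : Type*} [DecidableEq α] {u : α → ℕ} {p q : α}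
    (h : u p = u q) {σ : Perm α} (hσ : σ ∈ permsOfFinset {p, q}) (i : α) : u (σ i) = u i := by
  by_cases hi : i ∈ ({p, q} : Finset α)
  · have hσi := (apply_mem_iff_of_mem_permsOfFinset hσ).2 hi
    simp only [mem_insert, mem_singleton] at hi hσi
    rcases hi with rfl | rfl <;> rcases hσi with hσi | hσi <;> rw [hσi] <;> simp [h]
  · rw [mem_permsOfFinset.1 hσ i hi]

theorem twistedSum_rowStabilizer_mul_symmetrizer (T : Tableau lam) {p q : Fin d} (hpq : p ≠ q)
    (h : (T.symm p).1.1 = (T.symm q).1.1) :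
    twistedSum 1 (rowStabilizer T) * symmetrizer 1 {p, q} = 2 • twistedSum 1 (rowStabilizer T) := by
  rw [symmetrizer, twistedSum_mul_twistedSum_eq_left, card_perms_of_finset, card_pair hpq,
    Nat.factorial_two]
  intro σ hσ τ
  have hσu := apply_eq_of_mem_permsOfFinset_pair (u := fun i => (T.symm i).1.1) h hσ
  simp only [rowStabilizer, mem_filter_univ, Perm.mul_apply]
  rw [← σ.forall_congr_right (q := fun i => (T.symm (τ i)).1.1 = (T.symm i).1.1)]
  simp only [hσu]

theorem symmetrizer_mul_twistedSum_colStabilizer (T : Tableau lam) {p q : Fin d} (hpq : p ≠ q)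
    (h : (T.symm p).1.2 = (T.symm q).1.2) :
    symmetrizer sign {p, q} * twistedSum sign (colStabilizer T) =
      2 • twistedSum sign (colStabilizer T) := by
  rw [symmetrizer, twistedSum_mul_twistedSum_eq_right, card_perms_of_finset, card_pair hpq,
    Nat.factorial_two]
  intro σ hσ τ
  have hσu := apply_eq_of_mem_permsOfFinset_pair (u := fun i => (T.symm i).1.2) h hσ
  simp only [colStabilizer, mem_filter_univ, Perm.mul_apply, hσu]

theorem commute_of_twistedSum_cyclesOn {α : Type*} [Fintype α] [DecidableEq α] (τ : Perm α) :
    Commute (of ℚ _ τ) (twistedSum 1 (cyclesOn univ)) := by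
  refine semiconjBy_twistedSum 1 fun σ => ?_
  simp only [mem_cyclesOn, mem_permsOfFinset, mem_univ, not_true, false_imp_iff, true_imp_iff,
    implies_true, true_and, sameCycle_conj]
  exact τ⁻¹.forall₂_congr τ⁻¹ Iff.rfl

theorem exists_corner_of_not_isHook (h : ¬ IsHook lam) (T : Tableau lam) :
    ∃ p q r s : Fin d, [p, q, r, s].Nodup ∧
      (T.symm p).1.1 = (T.symm q).1.1 ∧ (T.symm r).1.1 = (T.symm s).1.1 ∧
      (T.symm p).1.2 = (T.symm r).1.2 ∧ (T.symm q).1.2 = (T.symm s).1.2 := by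
  have hmem {i j : ℕ} (hi : i ≤ 1) (hj : j ≤ 1) : (i, j) ∈ (diagram lam).cells :=
    (diagram lam).up_left_mem hi hj (not_not.1 h)
  exact ⟨T ⟨(0, 0), hmem zero_le_one zero_le_one⟩, T ⟨(0, 1), hmem zero_le_one le_rfl⟩,
    T ⟨(1, 0), hmem le_rfl zero_le_one⟩, T ⟨(1, 1), hmem le_rfl le_rfl⟩, by simp, by simp⟩

theorem twistedSum_cyclesOn_mul_youngSymmetrizer (h : ¬ IsHook lam) (T : Tableau lam) :
    twistedSum 1 (cyclesOn univ) * youngSymmetrizer T = 0 := by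
  obtain ⟨p, q, r, s, hne, hpq, hrs, hpr, hqs⟩ := exists_corner_of_not_isHook h T
  have hsq := twistedSum_cyclesOn_mul_squareSymmetrizer hne
  simp only [List.nodup_cons, List.mem_cons, List.not_mem_nil, or_false, not_or,
    not_false_eq_true, List.nodup_nil, and_true] at hne
  set K := twistedSum (1 : Perm (Fin d) →* ℤˣ) (cyclesOn univ)
  set R := twistedSum (1 : Perm (Fin d) →* ℤˣ) (rowStabilizer T)
  set C := twistedSum sign (colStabilizer T)
  have hRK : Commute R K := commute_twistedSum_left fun τ _ => commute_of_twistedSum_cyclesOn τ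
  have hrow : R * (symmetrizer 1 {p, q} * symmetrizer 1 {r, s}) = (2 * 2) • R := by
    rw [← mul_assoc, twistedSum_rowStabilizer_mul_symmetrizer T hne.1.1 hpq, smul_mul_assoc,
      twistedSum_rowStabilizer_mul_symmetrizer T hne.2.2 hrs, smul_smul]
  have hcol : symmetrizer sign {p, r} * symmetrizer sign {q, s} * C = (2 * 2) • C := by
    rw [mul_assoc, symmetrizer_mul_twistedSum_colStabilizer T hne.2.1.2 hqs, mul_smul_comm,
      symmetrizer_mul_twistedSum_colStabilizer T hne.1.2.1 hpr, smul_smul]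
  have hzero : (2 * 2) • (2 * 2) • (K * (R * C)) = 0 := by
    calc (2 * 2) • (2 * 2) • (K * (R * C)) = K * (((2 * 2) • R) * ((2 * 2) • C)) := by
          rw [smul_mul_smul_comm, mul_smul_comm, smul_smul]
      _ = R * (K * squareSymmetrizer p q r s) * C := by
          rw [← hrow, ← hcol, squareSymmetrizer]
          simp only [← mul_assoc, hRK.eq]
      _ = 0 := by rw [hsq, mul_zero, zero_mul]
  have : IsAddTorsionFree (MonoidAlgebra ℚ (Perm (Fin d))) := .of_module_rat _
  rw [youngSymmetrizer_eq_twistedSum]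
  exact (smul_eq_zero_iff_right (by norm_num)).1 ((smul_eq_zero_iff_right (by norm_num)).1 hzero)

theorem sum_character_spechtRep {K : Finset (Perm (Fin d))}
    (hcomm : ∀ τ, Commute (of ℚ _ τ) (twistedSum 1 K))
    (hK : twistedSum 1 K * youngSymmetrizer (tableau lam) = 0) :
    ∑ σ ∈ K, (spechtRep lam).character σ = 0 := by
  have hcentral (z : MonoidAlgebra ℚ (Perm (Fin d))) : Commute z (twistedSum 1 K) := by
    induction z using MonoidAlgebra.induction_on with
    | of τ => exact hcomm τ
    | add x y hx hy => exact hx.add_left hy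
    | smul r x hx => exact hx.smul_left r
  have hzero : ∑ σ ∈ K, spechtRep lam σ = 0 := by
    refine LinearMap.ext fun ⟨x, hx⟩ => Subtype.ext ?_
    obtain ⟨z, rfl⟩ := Submodule.mem_span_singleton.1 hx
    rw [LinearMap.sum_apply, Submodule.coe_sum, LinearMap.zero_apply, Submodule.coe_zero]
    calc ∑ σ ∈ K, of ℚ _ σ * (z * youngSymmetrizer (tableau lam))
        = twistedSum 1 K * (z * youngSymmetrizer (tableau lam)) := by
          simp only [twistedSum, MonoidHom.one_apply, one_smul, sum_mul]
      _ = 0 := by rw [← mul_assoc, ← (hcentral z).eq, mul_assoc, hK, mul_zero]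
  simp only [Representation.character]
  rw [← map_sum, hzero, map_zero]

theorem chi_indiscrete_of_not_isHook (h : ¬ IsHook lam) :
    chi lam (Nat.Partition.indiscrete d) = 0 := by
  obtain ⟨p, q, _, _, hpq, -⟩ := exists_corner_of_not_isHook h (tableau lam)
  have : Nontrivial (Fin d) := ⟨p, q, fun h => by simp [h] at hpq⟩
  have hd : d ≠ 0 := p.pos.ne'
  have hg := (exists_perm_of_partition (Nat.Partition.indiscrete d)).choose_spec
  rw [chi]
  set g := (exists_perm_of_partition (Nat.Partition.indiscrete d)).choose
  rw [Nat.Partition.indiscrete_parts hd] at hg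
  have hconst : ∀ σ ∈ cyclesOn (univ : Finset (Fin d)),
      (spechtRep lam).character σ = (spechtRep lam).character g := fun σ hσ => by
    have hconj : IsConj g σ := partition_eq_of_isConj.2 <| Nat.Partition.ext <| by
      rw [hg, parts_partition_of_mem_cyclesOn_univ hσ, Fintype.card_fin]
    obtain ⟨τ, rfl⟩ := isConj_iff.1 hconj
    rw [Representation.char_conj]
  have hsum := sum_character_spechtRep commute_of_twistedSum_cyclesOn
    (twistedSum_cyclesOn_mul_youngSymmetrizer h (tableau lam))
  rw [sum_congr rfl hconst, sum_const, smul_eq_zero] at hsum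
  exact hsum.resolve_left (card_ne_zero.2 cyclesOn_univ_nonempty)

end NonHooks

section HookSum

open Polynomial

variable {d : ℕ} {lam : d.Partition}

theorem parts_eq_map_rowLen (lam : d.Partition) :
    lam.parts = (Multiset.range (Multiset.card lam.parts)).map (diagram lam).rowLen := by
  conv_lhs => rw [← Multiset.sort_eq lam.parts (· ≥ ·), ← rowLens_diagram, YoungDiagram.rowLens,
    colLen_diagram_zero]
  rfl

theorem sum_rowLen (lam : d.Partition) :
    ∑ i ∈ range (Multiset.card lam.parts), (diagram lam).rowLen i = d := by
  conv_rhs => rw [← lam.parts_sum, parts_eq_map_rowLen]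
  rfl

theorem IsHook.rowLen_succ (h : IsHook lam) {i : ℕ} (hi : i + 1 < Multiset.card lam.parts) :
    (diagram lam).rowLen (i + 1) = 1 := by
  have hle : (diagram lam).rowLen 1 ≤ 1 := by
    rwa [IsHook, YoungDiagram.mem_iff_lt_rowLen, not_lt] at h
  have hanti := (diagram lam).rowLen_anti 1 (i + 1) (by omega)
  have hpos : 0 < (diagram lam).rowLen (i + 1) := by
    rwa [← YoungDiagram.mem_iff_lt_rowLen, YoungDiagram.mem_iff_lt_colLen, colLen_diagram_zero]
  omega

theorem IsHook.rowLen_zero_add (h : IsHook lam) {k : ℕ}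
    (hk : Multiset.card lam.parts = k + 1) : (diagram lam).rowLen 0 + k = d := by
  have hsum := sum_rowLen lam
  rw [hk, sum_range_succ', sum_congr rfl fun i hi =>
    h.rowLen_succ (by rw [hk]; simpa using hi), sum_const, card_range, smul_eq_mul, mul_one] at hsum
  rw [add_comm, hsum]

theorem IsHook.eq_of_card_parts_eq {mu : d.Partition} (h : IsHook lam) (h' : IsHook mu)
    (hc : Multiset.card lam.parts = Multiset.card mu.parts) : lam = mu := by
  ext1
  rw [parts_eq_map_rowLen lam, parts_eq_map_rowLen mu, ← hc]
  refine Multiset.map_congr rfl fun i hi => ?_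
  rw [Multiset.mem_range] at hi
  cases i with
  | zero =>
    have hk := (Nat.sub_add_cancel hi).symm
    have hlam := h.rowLen_zero_add hk
    have hmu := h'.rowLen_zero_add (hc ▸ hk)
    omega
  | succ i => rw [h.rowLen_succ hi, h'.rowLen_succ (hc ▸ hi)]

/-- The hook with one part `d - k` and `k` parts `1`. -/
def hookPartition (k : Fin d) : d.Partition where
  parts := (d - k) ::ₘ Multiset.replicate k 1
  parts_pos := by
    intro i hi
    rcases Multiset.mem_cons.1 hi with rfl | hi
    · omega
    · exact (Multiset.eq_of_mem_replicate hi).symm ▸ one_pos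
  parts_sum := by
    rw [Multiset.sum_cons, Multiset.sum_replicate, smul_eq_mul, mul_one,
      Nat.sub_add_cancel k.is_lt.le]

theorem card_parts_hookPartition (k : Fin d) :
    Multiset.card (hookPartition k).parts = k + 1 := by
  simp [hookPartition]

theorem hookPartition_injective : Function.Injective (hookPartition (d := d)) := fun k l hkl => by
  have := congrArg (fun lam => Multiset.card lam.parts) hkl
  simpa only [card_parts_hookPartition, Nat.add_right_cancel_iff, Fin.val_inj] using this

theorem isHook_hookPartition (k : Fin d) : IsHook (hookPartition k) := by
  have hsort : (hookPartition k).parts.sort (· ≥ ·) =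
      (d - k) :: (Multiset.replicate k 1).sort (· ≥ ·) := by
    refine Multiset.sort_cons (d - k) (Multiset.replicate k 1) (· ≥ ·) fun b hb => ?_
    rw [Multiset.eq_of_mem_replicate hb]
    omega
  rw [IsHook, diagram, YoungDiagram.mem_ofRowLens]
  rintro ⟨hlen, hlt⟩
  simp only [hsort, List.getElem_cons_succ] at hlt
  rw [Multiset.eq_of_mem_replicate ((Multiset.mem_sort (· ≥ ·)).1 (List.getElem_mem _))] at hlt
  exact lt_irrefl 1 hlt

theorem IsHook.exists_hookPartition_eq (hd : 0 < d) (h : IsHook lam) :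
    ∃ k, hookPartition k = lam := by
  have hcard : Multiset.card lam.parts ≠ 0 := fun h0 => by
    have := lam.parts_sum
    rw [Multiset.card_eq_zero.1 h0, Multiset.sum_zero] at this
    omega
  obtain ⟨k, hk⟩ := Nat.exists_eq_succ_of_ne_zero hcard
  have hpos : 0 < (diagram lam).rowLen 0 := by
    rw [← YoungDiagram.mem_iff_lt_rowLen, YoungDiagram.mem_iff_lt_colLen, colLen_diagram_zero]
    omega
  have hkd := h.rowLen_zero_add hk
  exact ⟨⟨k, by omega⟩,
    (isHook_hookPartition _).eq_of_card_parts_eq h (by rw [card_parts_hookPartition, hk])⟩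

theorem sum_partition_eq_sum_hookPartition (hd : 0 < d) (F : d.Partition → ℚ)
    (hF : ∀ lam, ¬ IsHook lam → F lam = 0) : ∑ lam, F lam = ∑ k, F (hookPartition k) :=
  (Fintype.sum_of_injective _ hookPartition_injective _ _
    (fun lam hlam => hF lam fun h => hlam (h.exists_hookPartition_eq hd)) fun _ => rfl).symm

theorem shiftedPowerSum_three_hookPartition (k : Fin d) :
    shiftedPowerSum 3 (hookPartition k) / 6 =
      (d : ℚ) ^ 3 / 24 + d / 2 * (((d : ℚ) - 1) / 2 - (k : ℕ)) ^ 2 := by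
  have hhook := isHook_hookPartition k
  have hcard := card_parts_hookPartition k
  have hterm : ∀ i ∈ range k, (((diagram (hookPartition k)).rowLen (i + 1) : ℚ) -
      ((i + 1 : ℕ) + 1) + 1 / 2) ^ 3 - (-(((i + 1 : ℕ) : ℚ) + 1) + 1 / 2) ^ 3 =
      (((i + 1 : ℕ) : ℚ) + 1 / 2) ^ 3 - ((i : ℚ) + 1 / 2) ^ 3 := by
    intro i hi
    rw [hhook.rowLen_succ (by rw [hcard]; simpa using hi)]
    push_cast
    ring
  have hd : (d : ℚ) = (diagram (hookPartition k)).rowLen 0 + (k : ℕ) := by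
    exact_mod_cast (hhook.rowLen_zero_add hcard).symm
  rw [shiftedPowerSum, hcard, sum_range_succ', sum_congr rfl hterm,
    sum_range_sub (fun i : ℕ => ((i : ℚ) + 1 / 2) ^ 3), hd]
  push_cast
  ring

theorem chi_hookPartition (k : Fin d) (mu : d.Partition) {Y : ℚ[X]}
    (hY : (1 - X) * Y = (mu.parts.map fun c => 1 - X ^ c).prod) :
    chi (hookPartition k) mu = (-1) ^ (k : ℕ) * Y.coeff k := by
  rw [(isHook_hookPartition k).chi_eq k.pos mu hY, card_parts_hookPartition, Nat.add_sub_cancel]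

theorem chi_hookPartition_indiscrete (k : Fin d) :
    chi (hookPartition k) (Nat.Partition.indiscrete d) = (-1) ^ (k : ℕ) := by
  have hY : (1 - X) * (∑ i ∈ range d, (X : ℚ[X]) ^ i) =
      ((Nat.Partition.indiscrete d).parts.map fun c => 1 - (X : ℚ[X]) ^ c).prod := by
    rw [Nat.Partition.indiscrete_parts k.pos.ne', Multiset.map_singleton, Multiset.prod_singleton,
      mul_neg_geom_sum]
  rw [chi_hookPartition k _ hY, finsetSum_coeff]
  simp [coeff_X_pow]

theorem sum_chi_indiscrete (hd : 0 < d) (mu : d.Partition) (s : ℕ) {Y : ℚ[X]}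
    (hY : (1 - X) * Y = (mu.parts.map fun c => 1 - X ^ c).prod) :
    ∑ lam : d.Partition, chi lam (Nat.Partition.indiscrete d) * (shiftedPowerSum 3 lam / 6) ^ s *
        chi lam mu =
      ∑ k ∈ range d,
        ((d : ℚ) ^ 3 / 24 + d / 2 * (((d : ℚ) - 1) / 2 - k) ^ 2) ^ s * Y.coeff k := by
  rw [sum_partition_eq_sum_hookPartition hd _ fun lam h => by
      rw [chi_indiscrete_of_not_isHook h, zero_mul, zero_mul],
    ← Fin.sum_univ_eq_sum_range (fun k =>
      ((d : ℚ) ^ 3 / 24 + d / 2 * (((d : ℚ) - 1) / 2 - k) ^ 2) ^ s * Y.coeff k)]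
  refine sum_congr rfl fun k _ => ?_
  have hsign : (-1 : ℚ) ^ (k : ℕ) * (-1) ^ (k : ℕ) = 1 := by
    rw [← mul_pow, neg_one_mul, neg_neg, one_pow]
  rw [chi_hookPartition_indiscrete, chi_hookPartition k mu hY,
    shiftedPowerSum_three_hookPartition, mul_right_comm, ← mul_assoc, hsign, one_mul, mul_comm]

end HookSum

section Series

open PowerSeries

/-- The power series `exp (t z)` in `z`. -/
noncomputable def expSeries (t : ℚ) : ℚ⟦X⟧ := rescale t (exp ℚ)

theorem expSeries_mul (a b : ℚ) : expSeries a * expSeries b = expSeries (a + b) :=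
  exp_mul_exp_eq_exp_add a b

theorem expSeries_zero : expSeries 0 = 1 := by simp [expSeries]

theorem rescale_expSeries (a t : ℚ) : rescale a (expSeries t) = expSeries (t * a) := by
  rw [expSeries, rescale_rescale, expSeries]

theorem expSeries_pow (t : ℚ) (k : ℕ) : expSeries t ^ k = expSeries (k * t) := by
  rw [expSeries, ← map_pow, exp_pow_eq_rescale_exp, rescale_rescale, expSeries]

theorem expSeries_sum {ι : Type*} (s : Finset ι) (f : ι → ℚ) :
    expSeries (∑ i ∈ s, f i) = ∏ i ∈ s, expSeries (f i) := by
  classical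
  induction s using Finset.induction_on with
  | empty => simp [expSeries_zero]
  | insert a s ha ih => rw [sum_insert ha, prod_insert ha, ← ih, expSeries_mul]

theorem coeff_expSeries (t : ℚ) (m : ℕ) : coeff m (expSeries t) = t ^ m / m.factorial := by
  simp [expSeries, coeff_rescale, coeff_exp, div_eq_mul_inv]

/-- The power series of `2 sinh (z / 2) = exp (z / 2) - exp (- z / 2)`. -/
noncomputable def sinhSeries : ℚ⟦X⟧ := expSeries (1 / 2) - expSeries (-1 / 2)

/-- The power series of `2 sinh (z / 2) / z`. -/
noncomputable def sinhcSeries : ℚ⟦X⟧ := mk fun m => coeff (m + 1) sinhSeries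

/-- The power series of `z / (2 sinh (z / 2))`, obtained from the generating function
`z / (exp z - 1)` of the Bernoulli numbers as `z / (exp (z / 2) - 1) - z / (exp z - 1)`. -/
noncomputable def invSinhcSeries : ℚ⟦X⟧ :=
  C 2 * rescale (1 / 2) (bernoulliPowerSeries ℚ) - bernoulliPowerSeries ℚ

theorem X_mul_sinhcSeries : X * sinhcSeries = sinhSeries := by
  ext m
  cases m with
  | zero =>
    rw [coeff_zero_X_mul, sinhSeries, map_sub, coeff_expSeries, coeff_expSeries, pow_zero, pow_zero,
      sub_self]
  | succ m => rw [coeff_succ_X_mul, sinhcSeries, coeff_mk]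

theorem constantCoeff_sinhcSeries : constantCoeff sinhcSeries = 1 := by
  rw [← coeff_zero_eq_constantCoeff_apply, sinhcSeries, coeff_mk, sinhSeries, map_sub,
    coeff_expSeries, coeff_expSeries]
  norm_num

theorem sinhSeries_eq_mul : sinhSeries = expSeries (1 / 2) * (1 - expSeries (-1)) := by
  rw [sinhSeries, mul_sub, mul_one, expSeries_mul]
  norm_num

theorem rescale_sinhSeries (t : ℚ) :
    rescale t sinhSeries = C t * X * rescale t sinhcSeries := by
  rw [← X_mul_sinhcSeries, map_mul, rescale_X]

theorem sinhcSeries_mul_invSinhcSeries : sinhcSeries * invSinhcSeries = 1 := by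
  have hexp_inv : expSeries (1 / 2) * expSeries (-1 / 2) = 1 := by
    rw [expSeries_mul, ← expSeries_zero]; norm_num
  have hbernoulli :
      bernoulliPowerSeries ℚ * (expSeries (1 / 2) * expSeries (1 / 2) - 1) = X := by
    rw [expSeries_mul, ← bernoulliPowerSeries_mul_exp_sub_one ℚ, expSeries]
    norm_num
  have hbernoulli_half :
      C 2 * rescale (1 / 2) (bernoulliPowerSeries ℚ) * (expSeries (1 / 2) - 1) = X := by
    rw [expSeries, ← map_one (rescale (1 / 2 : ℚ)), ← map_sub, mul_assoc, ← map_mul,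
      bernoulliPowerSeries_mul_exp_sub_one, rescale_X, ← mul_assoc, ← map_mul]
    norm_num
  refine X_mul_cancel ?_
  rw [← mul_assoc, X_mul_sinhcSeries, mul_one, sinhSeries, invSinhcSeries]
  linear_combination -expSeries (1 / 2) * (C 2 * rescale (1 / 2) (bernoulliPowerSeries ℚ) -
    bernoulliPowerSeries ℚ) * hexp_inv +
    expSeries (-1 / 2) * (expSeries (1 / 2) + 1) * hbernoulli_half -
    expSeries (-1 / 2) * hbernoulli + X * hexp_inv

theorem coeff_invSinhcSeries (m : ℕ) :
    coeff m invSinhcSeries = (2 * (1 / 2) ^ m - 1) * (bernoulli m / m.factorial) := by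
  rw [invSinhcSeries, map_sub, coeff_C_mul, coeff_rescale, bernoulliPowerSeries, coeff_mk,
    Algebra.algebraMap_self, RingHom.id_apply]
  ring

theorem abs_bernoulli_two_mul {g : ℕ} (hg : g ≠ 0) :
    |bernoulli (2 * g)| = (-1) ^ (g + 1) * bernoulli (2 * g) := by
  suffices hnonneg : 0 ≤ (-1 : ℚ) ^ (g + 1) * bernoulli (2 * g) by
    rw [← abs_of_nonneg hnonneg, abs_mul, abs_pow, abs_neg, abs_one, one_pow, one_mul]
  have hzeta : (0 : ℝ) ≤ (2 ^ (2 * g - 1) * Real.pi ^ (2 * g) / (2 * g).factorial) *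
      (((-1 : ℚ) ^ (g + 1) * bernoulli (2 * g) : ℚ) : ℝ) := by
    refine ((hasSum_zeta_nat hg).nonneg fun n => by positivity).trans_eq ?_
    push_cast
    ring
  exact_mod_cast nonneg_of_mul_nonneg_right hzeta (by have := Real.pi_pos; positivity)

theorem neg_one_pow_mul_coeff_invSinhcSeries (g : ℕ) :
    (-1) ^ g * coeff (2 * g) invSinhcSeries =
      |(2 : ℚ) ^ (2 * (g : ℤ) - 1) - 1| * |bernoulli (2 * g)| /
        ((2 * g).factorial * (2 : ℚ) ^ (2 * (g : ℤ) - 1)) := by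
  rw [coeff_invSinhcSeries]
  rcases eq_or_ne g 0 with rfl | hg
  · norm_num
  · have hpow : (1 / 2 : ℚ) ^ (2 * g) = 1 / (2 * 2 ^ (2 * (g : ℤ) - 1)) := by
      rw [← zpow_one_add₀ two_ne_zero, one_div_pow, ← zpow_natCast]
      congr 2
      push_cast
      ring
    have hone : (1 : ℚ) ≤ 2 ^ (2 * (g : ℤ) - 1) := one_le_zpow₀ one_le_two (by omega)
    rw [hpow, abs_bernoulli_two_mul hg, abs_of_nonneg (sub_nonneg.2 hone)]
    field_simp
    ring

variable {ι : Type*} [Fintype ι]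

theorem natDegree_lt_of_one_sub_X_mul_eq {β : ι → ℕ} (hd : 0 < ∑ i, β i) {Y : Polynomial ℚ}
    (hY : (1 - Polynomial.X) * Y = ∏ i, (1 - Polynomial.X ^ β i)) :
    Y.natDegree < ∑ i, β i := by
  rcases eq_or_ne Y 0 with rfl | hY0
  · simpa using hd
  have hX : (1 - Polynomial.X : Polynomial ℚ).natDegree = 1 := by
    rw [← neg_sub, Polynomial.natDegree_neg, ← Polynomial.C_1, Polynomial.natDegree_X_sub_C]
  have hX0 : (1 - Polynomial.X : Polynomial ℚ) ≠ 0 :=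
    Polynomial.ne_zero_of_natDegree_gt (hX ▸ one_pos)
  have hprod : (∏ i, (1 - Polynomial.X ^ β i : Polynomial ℚ)).natDegree ≤ ∑ i, β i :=
    (Polynomial.natDegree_prod_le _ _).trans <| sum_le_sum fun i _ =>
      (Polynomial.natDegree_sub_le _ _).trans (by simp)
  rw [← hY, Polynomial.natDegree_mul hX0 hY0, hX] at hprod
  omega

theorem sum_coeff_mul_expSeries_mul_sinhSeries {β : ι → ℕ} (hd : 0 < ∑ i, β i)
    {Y : Polynomial ℚ} (hY : (1 - Polynomial.X) * Y = ∏ i, (1 - Polynomial.X ^ β i)) :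
    (∑ k ∈ range (∑ i, β i), C (Y.coeff k) *
      expSeries ((((∑ i, β i : ℕ) : ℚ) - 1) / 2 - k)) * sinhSeries =
      ∏ i, rescale (β i : ℚ) sinhSeries := by
  have hsinh (t : ℕ) :
      rescale (t : ℚ) sinhSeries = expSeries (t / 2) * (1 - expSeries (-1) ^ t) := by
    rw [sinhSeries_eq_mul, map_mul, map_sub, map_one, rescale_expSeries, rescale_expSeries,
      expSeries_pow]
    congr 2
    · ring
    · rw [mul_comm]
  have hY_exp : (1 - expSeries (-1)) *
      ∑ k ∈ range (∑ i, β i), C (Y.coeff k) * expSeries (-1) ^ k =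
      ∏ i, (1 - expSeries (-1) ^ β i) := by
    have h := congrArg (Polynomial.aeval (expSeries (-1))) hY
    rw [map_mul, map_prod,
      Polynomial.aeval_eq_sum_range' (natDegree_lt_of_one_sub_X_mul_eq hd hY)] at h
    simpa only [map_sub, map_one, Polynomial.aeval_X, map_pow, smul_eq_C_mul] using h
  have hshift (k : ℕ) : expSeries ((((∑ i, β i : ℕ) : ℚ) - 1) / 2 - k) * expSeries (1 / 2) =
      expSeries (((∑ i, β i : ℕ) : ℚ) / 2) * expSeries (-1) ^ k := by
    rw [expSeries_pow, expSeries_mul, expSeries_mul]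
    congr 1
    ring
  simp only [hsinh]
  rw [prod_mul_distrib, ← expSeries_sum, ← sum_div, ← Nat.cast_sum, ← hY_exp, sinhSeries_eq_mul,
    mul_sum, mul_sum, sum_mul]
  refine sum_congr rfl fun k _ => ?_
  linear_combination C (Y.coeff k) * (1 - expSeries (-1)) * hshift k

theorem X_mul_sum_coeff_mul_expSeries {β : ι → ℕ} (hd : 0 < ∑ i, β i)
    {Y : Polynomial ℚ} (hY : (1 - Polynomial.X) * Y = ∏ i, (1 - Polynomial.X ^ β i)) :
    X * ∑ k ∈ range (∑ i, β i), C (Y.coeff k) *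
        expSeries ((((∑ i, β i : ℕ) : ℚ) - 1) / 2 - k) =
      C (∏ i, (β i : ℚ)) * (X ^ Fintype.card ι *
        ((∏ i, rescale (β i : ℚ) sinhcSeries) * invSinhcSeries)) := by
  have h := sum_coeff_mul_expSeries_mul_sinhSeries hd hY
  simp only [rescale_sinhSeries] at h
  rw [prod_mul_distrib, prod_mul_distrib, prod_const, card_univ, ← map_prod,
    ← X_mul_sinhcSeries] at h
  linear_combination invSinhcSeries * h - X * (∑ k ∈ range (∑ i, β i), C (Y.coeff k) *
    expSeries ((((∑ i, β i : ℕ) : ℚ) - 1) / 2 - k)) * sinhcSeries_mul_invSinhcSeries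

theorem sum_pow_mul_coeff {β : ι → ℕ} (hd : 0 < ∑ i, β i)
    {Y : Polynomial ℚ} (hY : (1 - Polynomial.X) * Y = ∏ i, (1 - Polynomial.X ^ β i)) (m : ℕ) :
    ∑ k ∈ range (∑ i, β i), ((((∑ i, β i : ℕ) : ℚ) - 1) / 2 - k) ^ m * Y.coeff k =
      (∏ i, (β i : ℚ)) * (m.factorial * coeff (m + 1) (X ^ Fintype.card ι *
        ((∏ i, rescale (β i : ℚ) sinhcSeries) * invSinhcSeries))) := by
  have h := congrArg (coeff (m + 1)) (X_mul_sum_coeff_mul_expSeries hd hY)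
  rw [coeff_succ_X_mul, map_sum, coeff_C_mul] at h
  simp only [coeff_C_mul, coeff_expSeries] at h
  have hm : (m.factorial : ℚ) ≠ 0 := by exact_mod_cast m.factorial_ne_zero
  rw [mul_left_comm, ← h, mul_sum]
  refine sum_congr rfl fun k _ => ?_
  field_simp

end Series

section Polynomial

open MvPolynomial

variable {σ : Type*} [Fintype σ] {n : ℕ}

/-- The coefficient of `z ^ m` in `z ^ (N - 1) ∏ S(X_i z) / S(z)`, where `N` is the number of
variables `X_i` and `S(z) = 2 sinh (z / 2) / z`. To allow `N = 0`, both exponents are shifted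
by `1`. -/
noncomputable def momentPoly (σ : Type*) [Fintype σ] (m : ℕ) : MvPolynomial σ ℚ :=
  PowerSeries.coeff (m + 1) (PowerSeries.X ^ Fintype.card σ *
    ((∏ i, PowerSeries.rescale (X i) (PowerSeries.map C sinhcSeries)) *
      PowerSeries.map C invSinhcSeries))

theorem eval_momentPoly (m : ℕ) (x : σ → ℚ) :
    eval x (momentPoly σ m) = PowerSeries.coeff (m + 1) (PowerSeries.X ^ Fintype.card σ *
      ((∏ i, PowerSeries.rescale (x i) sinhcSeries) * invSinhcSeries)) := by
  have hmap (f : PowerSeries ℚ) : PowerSeries.map (eval x) (PowerSeries.map C f) = f := by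
    ext k
    simp
  rw [momentPoly, ← PowerSeries.coeff_map, map_mul (PowerSeries.map _), map_mul (PowerSeries.map _),
    map_prod, map_pow, PowerSeries.map_X, hmap]
  simp only [← PowerSeries.rescale_map, eval_X, hmap]

theorem constantCoeff_momentPoly (m : ℕ) :
    constantCoeff (momentPoly σ m) =
      PowerSeries.coeff (m + 1) (PowerSeries.X ^ Fintype.card σ * invSinhcSeries) := by
  rw [← eval_zero', eval_momentPoly]
  simp [PowerSeries.rescale_zero, constantCoeff_sinhcSeries]

theorem coeff_mul_of_isHomogeneous {τ R : Type*} [CommSemiring R] {φ ψ : MvPolynomial τ R}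
    {m : ℕ} (hφ : φ.IsHomogeneous m) {b : τ →₀ ℕ} (hb : b.degree ≤ m) :
    coeff b (φ * ψ) = coeff b φ * constantCoeff ψ := by
  classical
  rw [coeff_mul, sum_eq_single_of_mem (b, 0) (by simp)]
  · rfl
  rintro ⟨p, q⟩ hpq hne
  obtain rfl : p + q = b := mem_antidiagonal.1 hpq
  rw [map_add] at hb
  rw [hφ.coeff_eq_zero fun hp => hne ?_, zero_mul]
  have hq : q.degree = 0 := by
    change p.degree = m at hp
    omega
  obtain rfl := (Finsupp.degree_eq_zero_iff q).1 hq
  rw [add_zero]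

/-- The polynomial `d H / s!`, as a function of the parts of the second partition, for one-part
double Hurwitz numbers with `s` completed 3-cycles. The sum over `j` is the binomial expansion of
`(d ^ 3 / 24 + d / 2 * x ^ 2) ^ s`, in which `x ^ (2 * j)` becomes a moment. -/
noncomputable def hurwitzPoly (σ : Type*) [Fintype σ] (s : ℕ) : MvPolynomial σ ℚ :=
  ∑ j ∈ range (s + 1),
    C ((s.choose j : ℚ) * (1 / 24) ^ (s - j) * (1 / 2) ^ j * (2 * j).factorial / s.factorial) *
      ((∑ i, X i) ^ (3 * (s - j) + j) * momentPoly σ (2 * j))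

theorem sum_add_mul_sq_pow_mul {ι R : Type*} [CommSemiring R] (t : Finset ι) (u v : R)
    (x y : ι → R) (s : ℕ) :
    ∑ k ∈ t, (u + v * x k ^ 2) ^ s * y k =
      ∑ j ∈ range (s + 1), (s.choose j : R) * u ^ (s - j) * v ^ j *
        ∑ k ∈ t, x k ^ (2 * j) * y k := by
  simp only [mul_sum]
  rw [sum_comm]
  refine sum_congr rfl fun k _ => ?_
  rw [add_comm, add_pow, sum_mul]
  refine sum_congr rfl fun j _ => ?_
  rw [mul_pow, ← pow_mul]
  ring

theorem sum_pow_mul_coeff_eq_eval_hurwitzPoly {β : σ → ℕ} (hd : 0 < ∑ i, β i)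
    {Y : Polynomial ℚ} (hY : (1 - Polynomial.X) * Y = ∏ i, (1 - Polynomial.X ^ β i)) (s : ℕ) :
    ∑ k ∈ range (∑ i, β i), (((∑ i, β i : ℕ) : ℚ) ^ 3 / 24 + ((∑ i, β i : ℕ) : ℚ) / 2 *
        ((((∑ i, β i : ℕ) : ℚ) - 1) / 2 - k) ^ 2) ^ s * Y.coeff k =
      (∏ i, (β i : ℚ)) * s.factorial * eval (fun i => (β i : ℚ)) (hurwitzPoly σ s) := by
  have hs : (s.factorial : ℚ) ≠ 0 := by exact_mod_cast s.factorial_ne_zero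
  rw [sum_add_mul_sq_pow_mul, hurwitzPoly, map_sum, mul_sum]
  refine sum_congr rfl fun j _ => ?_
  rw [sum_pow_mul_coeff hd hY, map_mul (eval _), map_mul (eval _), eval_C, map_pow, map_sum,
    eval_momentPoly]
  simp only [eval_X, Nat.cast_sum]
  field_simp
  ring

theorem parts_partitionOf {β : Fin n → ℕ} (hβ : ∀ i, 0 < β i) :
    (partitionOf β).parts = univ.val.map β := by
  refine (Nat.Partition.ofSums_parts _ _ _).trans (Multiset.filter_eq_self.2 fun a ha => ?_)
  obtain ⟨i, -, rfl⟩ := Multiset.mem_map.1 ha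
  exact (hβ i).ne'

theorem sum_pos_of_odd (hn : Odd n) {β : Fin n → ℕ} (hβ : ∀ i, 0 < β i) : 0 < ∑ i, β i :=
  sum_pos (fun i _ => hβ i) ⟨⟨0, hn.pos⟩, mem_univ _⟩

theorem onePartHurwitz_eq {g : ℕ} (hn : Odd n) {β : Fin n → ℕ} (hβ : ∀ i, 0 < β i)
    {Y : Polynomial ℚ}
    (hY : (1 - Polynomial.X) * Y = ∏ i, (1 - Polynomial.X ^ β i)) :
    onePartHurwitz g β = 1 / (((∑ i, β i : ℕ) : ℚ) * ∏ i, (β i : ℚ)) *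
      ∑ k ∈ range (∑ i, β i), (((∑ i, β i : ℕ) : ℚ) ^ 3 / 24 + ((∑ i, β i : ℕ) : ℚ) / 2 *
        ((((∑ i, β i : ℕ) : ℚ) - 1) / 2 - k) ^ 2) ^ (g + (n - 1) / 2) * Y.coeff k := by
  have hd := sum_pos_of_odd hn hβ
  have hexp : (2 * g + Multiset.card (Nat.Partition.indiscrete (∑ i, β i)).parts +
      Multiset.card (partitionOf β).parts - 2) / 2 = g + (n - 1) / 2 := by
    rw [Nat.Partition.indiscrete_parts hd.ne', parts_partitionOf hβ, Multiset.card_singleton,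
      Multiset.card_map, card_val, card_univ, Fintype.card_fin]
    obtain ⟨m, rfl⟩ := hn
    omega
  have hfac : (((2 + 1).factorial : ℕ) : ℚ) = 6 := by norm_num [Nat.factorial]
  have hY_parts : (1 - Polynomial.X) * Y =
      ((partitionOf β).parts.map fun c => 1 - (Polynomial.X : Polynomial ℚ) ^ c).prod := by
    rw [hY, parts_partitionOf hβ, Multiset.map_map]
    rfl
  rw [onePartHurwitz, hurwitz, hexp, hfac, sum_chi_indiscrete hd _ _ hY_parts,
    Nat.Partition.indiscrete_parts hd.ne', parts_partitionOf hβ, Multiset.prod_singleton,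
    ← Finset.prod_eq_multiset_prod, Nat.cast_prod]

theorem isHurwitzPolynomial_hurwitzPoly (g : ℕ) (hn : Odd n) :
    IsHurwitzPolynomial g n (hurwitzPoly (Fin n) (g + (n - 1) / 2)) := by
  intro β hβ
  have : NeZero n := ⟨hn.pos.ne'⟩
  have hd := sum_pos_of_odd hn hβ
  obtain ⟨Y, hY⟩ : (1 - Polynomial.X : Polynomial ℚ) ∣ ∏ i, (1 - Polynomial.X ^ β i) := by
    refine dvd_trans ?_ (dvd_prod_of_mem _ (mem_univ 0))
    simpa using sub_dvd_pow_sub_pow (1 : Polynomial ℚ) Polynomial.X (β 0)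
  have hd0 : ((∑ i, β i : ℕ) : ℚ) ≠ 0 := by exact_mod_cast hd.ne'
  have hprod : ∏ i, (β i : ℚ) ≠ 0 := prod_ne_zero_iff.2 fun i _ => by exact_mod_cast (hβ i).ne'
  have hs : ((g + (n - 1) / 2).factorial : ℚ) ≠ 0 := by exact_mod_cast Nat.factorial_ne_zero _
  rw [onePartHurwitz_eq hn hβ hY.symm, sum_pow_mul_coeff_eq_eval_hurwitzPoly hd hY.symm]
  field_simp

theorem IsHurwitzPolynomial.unique {g : ℕ} {P Q : MvPolynomial (Fin n) ℚ}
    (hP : IsHurwitzPolynomial g n P) (hQ : IsHurwitzPolynomial g n Q) : P = Q := by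
  have hinj : Function.Injective fun k : ℕ => ((k + 1 : ℕ) : ℚ) := fun a b hab => by
    simpa using hab
  refine funext_set _ (fun _ => Set.infinite_range_of_injective hinj) fun x hx => ?_
  choose k hk using fun i => hx i (Set.mem_univ i)
  obtain rfl : (fun i => ((k i + 1 : ℕ) : ℚ)) = x := funext hk
  rw [hP (fun i => k i + 1) fun i => Nat.succ_pos _,
    hQ (fun i => k i + 1) fun i => Nat.succ_pos _]

theorem hodgeIntegral_eq {g : ℕ} {P : MvPolynomial (Fin n) ℚ} (hP : IsHurwitzPolynomial g n P)
    (k : ℕ) (b : Fin n → ℕ) :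
    hodgeIntegral g k b = (-1) ^ k * coeff (Finsupp.equivFunOnFinite.symm b) P := by
  have hex : ∃ P : MvPolynomial (Fin n) ℚ, IsHurwitzPolynomial g n P := ⟨P, hP⟩
  rw [hodgeIntegral, dif_pos hex, hex.choose_spec.unique hP]

theorem isHomogeneous_sum_X_pow (m : ℕ) :
    ((∑ i : σ, X i : MvPolynomial σ ℚ) ^ m).IsHomogeneous m := by
  simpa using (IsHomogeneous.sum univ _ 1 fun i _ => isHomogeneous_X ℚ i).pow m

theorem coeff_hurwitzPoly {s : ℕ} {b : σ →₀ ℕ} (hb : b.degree = s) :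
    coeff b (hurwitzPoly σ s) =
      (1 / 2) ^ s * (2 * s).factorial / s.factorial * (b.multinomial *
        PowerSeries.coeff (2 * s + 1) (PowerSeries.X ^ Fintype.card σ * invSinhcSeries)) := by
  rw [hurwitzPoly, coeff_sum, sum_eq_single_of_mem s (self_mem_range_succ s)]
  · rw [coeff_C_mul, coeff_mul_of_isHomogeneous (isHomogeneous_sum_X_pow _) (by omega),
      coeff_sum_X_pow_of_fintype, if_pos (by simpa [Finsupp.degree_apply, Finsupp.sum] using hb),
      constantCoeff_momentPoly, Nat.choose_self, Nat.sub_self, pow_zero, Nat.cast_one, one_mul,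
      one_mul]
  · intro j hj hjs
    have hj' : j < s := lt_of_le_of_ne (mem_range_succ_iff.1 hj) hjs
    rw [coeff_C_mul, coeff_mul_of_isHomogeneous (isHomogeneous_sum_X_pow _) (by omega),
      (isHomogeneous_sum_X_pow _).coeff_eq_zero (by omega), zero_mul, mul_zero]

theorem neg_one_pow_mul_coeff_hurwitzPoly {g : ℕ} (hn : Odd n) {b : Fin n → ℕ}
    (hb : ∑ i, b i = g + (n - 1) / 2) :
    (-1) ^ g * coeff (Finsupp.equivFunOnFinite.symm b)
        (hurwitzPoly (Fin n) (g + (n - 1) / 2)) =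
      (Nat.multinomial univ b : ℚ) * hodgeConstant g n := by
  have hdeg : (Finsupp.equivFunOnFinite.symm b).degree = g + (n - 1) / 2 := by
    rw [Finsupp.degree_eq_sum, ← hb]
    rfl
  have hmult : (Finsupp.equivFunOnFinite.symm b).multinomial = Nat.multinomial univ b :=
    (Finsupp.multinomial_of_support_subset (subset_univ _)).symm
  have hs : 2 * (g + (n - 1) / 2) + 1 = 2 * g + n := by
    obtain ⟨m, rfl⟩ := hn
    omega
  have hzpow : (2 : ℚ) ^ (3 * (g : ℤ) + ((n : ℤ) - 3) / 2) =
      2 ^ (g + (n - 1) / 2) * 2 ^ (2 * (g : ℤ) - 1) := by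
    rw [← zpow_natCast, ← zpow_add₀ two_ne_zero]
    congr 1
    obtain ⟨m, rfl⟩ := hn
    push_cast
    omega
  rw [coeff_hurwitzPoly hdeg, hmult, hs, Fintype.card_fin, PowerSeries.coeff_X_pow_mul,
    show 2 * (g + (n - 1) / 2) = 2 * g + n - 1 by omega, mul_left_comm ((-1) ^ g),
    mul_left_comm ((-1) ^ g), neg_one_pow_mul_coeff_invSinhcSeries, hodgeConstant, hzpow,
    one_div_pow]
  field_simp

end Polynomial

end CompletedCycles

theorem proposition4p2 (g n : ℕ) (hn : Odd n) :
    (∃! P : MvPolynomial (Fin n) ℚ, CompletedCycles.IsHurwitzPolynomial g n P) ∧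
      ∀ b : Fin n → ℕ, ∑ i, b i = g + (n - 1) / 2 →
        CompletedCycles.hodgeIntegral g g b =
          (Nat.multinomial Finset.univ b : ℚ) * CompletedCycles.hodgeConstant g n := by
  have hP := CompletedCycles.isHurwitzPolynomial_hurwitzPoly g hn
  refine ⟨⟨_, hP, fun Q hQ => hQ.unique hP⟩, fun b hb => ?_⟩
  rw [CompletedCycles.hodgeIntegral_eq hP, CompletedCycles.neg_one_pow_mul_coeff_hurwitzPoly hn hb]
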